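/- There exist universal constants $c_0, C > 0$ such that the following holds. Let $d, m, n$ be natural numbers, let $\delta \in (0,1)$, and assume $$ m\wedge n \ge c_0\bigl(d\log d + \log(1/\delta)\bigr) \quad\text{and}\quad mn \ge c_0\, d\,\bigl(d\log d + \log(1/\delta)\bigr)\bigl(d + \log(1/\delta)\bigr). $$ For a matrix $A \in \mathbb{R}^{d\times d}$ and a permutation $\pi$ of $\{1,\dots,d\}$ write $(A^\pi)_{i,j} = A_{\pi(i),\pi(j)}$ and $\langle A,B\rangle = \mathrm{Tr}(AB^\top)$, $\|A\|_F = \sqrt{\langle A,A\rangle}$. Let $\pi^\star$ be any permutation of $\{1,\dots,d\}$, let $\Sigma \in \mathbb{R}^{d\times d}$ be any symmetric positive definite matrix with $\|\Sigma\|_{\mathrm{op}} \le 1$, and let $X_1,\dots,X_m \sim \mathcal{N}(0,\Sigma)$ and $Y_1,\dots,Y_n \sim \mathcal{N}(0,\Sigma^{\pi^\star})$ be i.i.d. samples, the two samples being independent of each other. Put $\widehat\Sigma_X = \frac1m\sum_{k=1}^m X_kX_k^\top$ and $\widehat\Sigma_Y = \frac1n\sum_{k=1}^n Y_kY_k^\top$,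 and call a permutation a quasi maximum likelihood estimator (QMLE) if it minimizes $\pi \mapsto \langle \widehat\Sigma_Y, (\widehat\Sigma_X^{\pi})^{-1}\rangle$ over all permutations of $\{1,\dots,d\}$. Then, with probability at least $1-\delta$, every QMLE $\widehat\pi$ satisfies $$ \|\Sigma^{\widehat\pi} - \Sigma^{\pi^\star}\|_F^2 \le C\left( \frac{d\log d + \log(1/\delta)}{m\wedge n} + \sqrt{\frac{d\,(d\log d+\log(1/\delta))(d+\log(1/\delta))}{mn}} \right). $$ -/

import Mathlib

open MeasureTheory ProbabilityTheory

noncomputable section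

namespace CovAlign

/-- `A^π`, the matrix with entries `(A^π) i j = A (π i) (π j)`. -/
def permute {d : ℕ} (A : Matrix (Fin d) (Fin d) ℝ) (π : Equiv.Perm (Fin d)) :
    Matrix (Fin d) (Fin d) ℝ :=
  Matrix.of fun i j => A (π i) (π j)

/-- The matrix inner product `⟨A, B⟩ = Tr (A Bᵀ)`. -/
def matInner {d : ℕ} (A B : Matrix (Fin d) (Fin d) ℝ) : ℝ :=
  (A * B.transpose).trace

/-- The Frobenius norm `‖A‖_F = √⟨A, A⟩`. -/
def frobNorm {d : ℕ} (A : Matrix (Fin d) (Fin d) ℝ) : ℝ :=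
  √(matInner A A)

/-- The Euclidean operator norm `max_{‖v‖₂ = 1} ‖A v‖₂`. -/
def opNorm {d : ℕ} (A : Matrix (Fin d) (Fin d) ℝ) : ℝ :=
  ‖Matrix.toEuclideanCLM (n := Fin d) (𝕜 := ℝ) A‖

/-- The (uncentred) sample covariance matrix `(1/m) ∑ k, x k (x k)ᵀ` of the vectors
`x 0, …, x (m - 1)`. -/
def sampleCov {d m : ℕ} (x : Fin m → EuclideanSpace ℝ (Fin d)) : Matrix (Fin d) (Fin d) ℝ :=
  Matrix.of fun i j => (∑ k, x k i * x k j) / (m : ℝ)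

/-- The empirical loss `⟨Σ̂_Y, (Σ̂_X^π)⁻¹⟩` whose minimizers are the quasi maximum likelihood
estimators. -/
def qmleRisk {d m n : ℕ} (x : Fin m → EuclideanSpace ℝ (Fin d))
    (y : Fin n → EuclideanSpace ℝ (Fin d)) (π : Equiv.Perm (Fin d)) : ℝ :=
  matInner (sampleCov y) (permute (sampleCov x) π)⁻¹

/-- `π` is a quasi maximum likelihood estimate for the samples `x`, `y`: it minimizes the
empirical loss over all permutations. -/
def IsQMLE {d m n : ℕ} (x : Fin m → EuclideanSpace ℝ (Fin d))
    (y : Fin n → EuclideanSpace ℝ (Fin d)) (π : Equiv.Perm (Fin d)) : Prop :=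
  ∀ π' : Equiv.Perm (Fin d), qmleRisk x y π ≤ qmleRisk x y π'

theorem exists_isQMLE {d m n : ℕ} (x : Fin m → EuclideanSpace ℝ (Fin d))
    (y : Fin n → EuclideanSpace ℝ (Fin d)) : ∃ π, IsQMLE x y π :=
  Finite.exists_min (qmleRisk x y)

/-- The covariance alignment model: `X` is an i.i.d. sample from `N(0, S)`, `Y` is an i.i.d. sample
from `N(0, S^π)`, and the two samples are independent of each other. -/
structure IsModel {d m n : ℕ} {Ω : Type*} [MeasurableSpace Ω] (P : Measure Ω)
    (S : Matrix (Fin d) (Fin d) ℝ) (π : Equiv.Perm (Fin d))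
    (X : Fin m → Ω → EuclideanSpace ℝ (Fin d)) (Y : Fin n → Ω → EuclideanSpace ℝ (Fin d)) :
    Prop where
  law_X : ∀ k, HasLaw (X k) (multivariateGaussian 0 S) P
  law_Y : ∀ k, HasLaw (Y k) (multivariateGaussian 0 (permute S π)) P
  indep_X : iIndepFun X P
  indep_Y : iIndepFun Y P
  indep_XY : IndepFun (fun ω k => X k ω) (fun ω k => Y k ω) P

end CovAlign

end

namespace CovAlign

open scoped Matrix.Norms.L2Operator
open Matrix

variable {d m n : ℕ}

/-! ### Frobenius norm and permutation of matrices -/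

/-! Whitening. Let `T = √Σ`, so that `X = T z` and `Y = T^{π⋆} w` with `z`, `w` independent standard
Gaussian samples with sample covariances `W_z`, `W_w`. For a competitor `π` put `Q = T^{π⋆}
(T^π)⁻¹`. The excess risk of `π` over `π⋆` splits exactly (`qmleRisk_sub_qmleRisk`) into `Tr(M
W_z⁻¹) + Tr(D (W_w - 1))`, where `M` is `QᵀQ - 1` with its indices permuted by `π⁻¹` and `D = Q
(W_z⁻¹)^π Qᵀ - (W_z⁻¹)^{π⋆}` depends on `z` only.

Signal. Since `det QᵀQ = 1`, `K = Tr(QᵀQ - 1)` is twice a Kullback–Leibler divergence between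
centred Gaussians. It is nonnegative and controls `a = ‖QᵀQ - 1‖_F` through `a² ≤ 8K + 4K²`
(`frobNorm_sq_sub_one_le`); in turn `a` dominates `‖Σ^π - Σ^{π⋆}‖_F` because `‖T‖ ≤ 1`
(`frobNorm_permute_sub_le`).

Noise. The first term is at least `K/2 - O(a √(t/m))` (`measure_trace_mul_inv_sampleCov_lt_le`).
This comes from a Maurey–Pisier comparison of two independent samples along a circle arc, followed
by averaging the second sample over `d` rotations, so that the expectation of `W_z⁻¹` is never
needed. Conditionally on `z`, Bernstein's inequality bounds the second term by `O(‖D‖_F √(t/n))`.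
Here `‖D‖_F ≤ a + g (2 + a)` with `g = ‖W_z⁻¹ - 1‖_F`, and an operator norm bound gives `g ≲ √(d (d
+ log(1/δ)) / m)`. The product of `g` with the second sample's noise produces the square root term
of the rate.

Conclusion. With `t` of order `d log d + log(1/δ)`, a union bound over the `d!` permutations makes
all this simultaneous. Nonpositive excess risk then gives an inequality between `K` and `a` that is
solved by absorption (`sq_le_of_basic_inequality`). -/

theorem matInner_eq_sum (A B : Matrix (Fin d) (Fin d) ℝ) :
    matInner A B = ∑ i, ∑ j, A i j * B i j := by
  simp [matInner, Matrix.trace, Matrix.mul_apply]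

theorem matInner_eq_inner (A B : Matrix (Fin d) (Fin d) ℝ) :
    matInner A B = inner ℝ (WithLp.toLp 2 (fun p : Fin d × Fin d => A p.1 p.2))
      (WithLp.toLp 2 (fun p : Fin d × Fin d => B p.1 p.2)) := by
  simp [matInner_eq_sum, PiLp.inner_apply, Fintype.sum_prod_type, mul_comm]

theorem frobNorm_eq_norm (A : Matrix (Fin d) (Fin d) ℝ) :
    frobNorm A = ‖WithLp.toLp 2 (fun p : Fin d × Fin d => A p.1 p.2)‖ := by
  rw [frobNorm, matInner_eq_inner, real_inner_self_eq_norm_sq, Real.sqrt_sq (norm_nonneg _)]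

theorem frobNorm_nonneg (A : Matrix (Fin d) (Fin d) ℝ) : 0 ≤ frobNorm A := Real.sqrt_nonneg _

theorem frobNorm_sq (A : Matrix (Fin d) (Fin d) ℝ) : frobNorm A ^ 2 = ∑ i, ∑ j, A i j ^ 2 := by
  rw [frobNorm_eq_norm, ← real_inner_self_eq_norm_sq, ← matInner_eq_inner, matInner_eq_sum]
  simp [sq]

theorem frobNorm_sq_eq_trace (A : Matrix (Fin d) (Fin d) ℝ) :
    frobNorm A ^ 2 = (A * Aᵀ).trace := by
  rw [frobNorm_eq_norm, ← real_inner_self_eq_norm_sq, ← matInner_eq_inner, matInner]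

theorem frobNorm_add_le (A B : Matrix (Fin d) (Fin d) ℝ) :
    frobNorm (A + B) ≤ frobNorm A + frobNorm B := by
  simp only [frobNorm_eq_norm]
  exact norm_add_le (WithLp.toLp 2 fun p : Fin d × Fin d => A p.1 p.2)
    (WithLp.toLp 2 fun p : Fin d × Fin d => B p.1 p.2)

theorem frobNorm_sub_le (A B : Matrix (Fin d) (Fin d) ℝ) :
    frobNorm (A - B) ≤ frobNorm A + frobNorm B := by
  simp only [frobNorm_eq_norm]
  exact norm_sub_le (WithLp.toLp 2 fun p : Fin d × Fin d => A p.1 p.2)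
    (WithLp.toLp 2 fun p : Fin d × Fin d => B p.1 p.2)

theorem frobNorm_neg (A : Matrix (Fin d) (Fin d) ℝ) : frobNorm (-A) = frobNorm A := by
  simp only [frobNorm_eq_norm]
  exact norm_neg (WithLp.toLp 2 fun p : Fin d × Fin d => A p.1 p.2)

theorem frobNorm_transpose (A : Matrix (Fin d) (Fin d) ℝ) : frobNorm Aᵀ = frobNorm A := by
  rw [← sq_eq_sq₀ (frobNorm_nonneg _) (frobNorm_nonneg _), frobNorm_sq, frobNorm_sq,
    Finset.sum_comm]
  simp

theorem abs_trace_mul_le (A B : Matrix (Fin d) (Fin d) ℝ) :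
    |(A * B).trace| ≤ frobNorm A * frobNorm B := by
  have h : (A * B).trace = matInner A Bᵀ := by simp [matInner]
  rw [h, matInner_eq_inner, ← frobNorm_transpose B, frobNorm_eq_norm, frobNorm_eq_norm]
  exact abs_real_inner_le_norm _ _

theorem sum_mulVec_sq_le (A : Matrix (Fin d) (Fin d) ℝ) (x : Fin d → ℝ) :
    ∑ i, (A *ᵥ x) i ^ 2 ≤ ‖A‖ ^ 2 * ∑ i, x i ^ 2 := by
  have h := Matrix.l2_opNorm_mulVec A (WithLp.toLp 2 x)
  have h2 := pow_le_pow_left₀ (norm_nonneg _) h 2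
  rw [mul_pow, EuclideanSpace.real_norm_sq_eq, EuclideanSpace.real_norm_sq_eq] at h2
  simpa using h2

theorem frobNorm_mul_le_opNorm_mul (A B : Matrix (Fin d) (Fin d) ℝ) :
    frobNorm (A * B) ≤ ‖A‖ * frobNorm B := by
  rw [← sq_le_sq₀ (frobNorm_nonneg _) (mul_nonneg (norm_nonneg _) (frobNorm_nonneg _)), mul_pow,
    frobNorm_sq, frobNorm_sq, Finset.sum_comm, Finset.sum_comm (f := fun i j => B i j ^ 2),
    Finset.mul_sum]
  exact Finset.sum_le_sum fun j _ => sum_mulVec_sq_le A fun i => B i j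

theorem l2_opNorm_transpose (A : Matrix (Fin d) (Fin d) ℝ) : ‖Aᵀ‖ = ‖A‖ := by
  simpa using Matrix.l2_opNorm_conjTranspose A

theorem frobNorm_mul_le_mul_opNorm (A B : Matrix (Fin d) (Fin d) ℝ) :
    frobNorm (A * B) ≤ frobNorm A * ‖B‖ := by
  have := frobNorm_mul_le_opNorm_mul Bᵀ Aᵀ
  rwa [← transpose_mul, frobNorm_transpose, frobNorm_transpose, l2_opNorm_transpose, mul_comm]
    at this

theorem opNorm_le_frobNorm (A : Matrix (Fin d) (Fin d) ℝ) : ‖A‖ ≤ frobNorm A := by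
  rw [Matrix.cstar_norm_def]
  refine ContinuousLinearMap.opNorm_le_bound _ (frobNorm_nonneg _) fun x => ?_
  rw [← sq_le_sq₀ (norm_nonneg _) (mul_nonneg (frobNorm_nonneg _) (norm_nonneg _)), mul_pow,
    EuclideanSpace.real_norm_sq_eq, EuclideanSpace.real_norm_sq_eq, frobNorm_sq, Finset.sum_mul]
  refine Finset.sum_le_sum fun i _ => ?_
  simpa [Matrix.mulVec, dotProduct] using
    Finset.sum_mul_sq_le_sq_mul_sq Finset.univ (fun j => A i j) (fun j => x j)

theorem frobNorm_mul_le (A B : Matrix (Fin d) (Fin d) ℝ) :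
    frobNorm (A * B) ≤ frobNorm A * frobNorm B :=
  (frobNorm_mul_le_opNorm_mul A B).trans
    (mul_le_mul_of_nonneg_right (opNorm_le_frobNorm A) (frobNorm_nonneg _))

theorem frobNorm_le_sqrt_mul_opNorm (A : Matrix (Fin d) (Fin d) ℝ) :
    frobNorm A ≤ √d * ‖A‖ := by
  have h := frobNorm_mul_le_opNorm_mul A 1
  have h1 : frobNorm (1 : Matrix (Fin d) (Fin d) ℝ) = √d := by
    simp [frobNorm, matInner]
  rwa [mul_one, h1, mul_comm] at h

theorem permute_eq_submatrix (A : Matrix (Fin d) (Fin d) ℝ) (π : Equiv.Perm (Fin d)) :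
    permute A π = A.submatrix π π := rfl

theorem permute_mul (A B : Matrix (Fin d) (Fin d) ℝ) (π : Equiv.Perm (Fin d)) :
    permute (A * B) π = permute A π * permute B π := by
  simp [permute_eq_submatrix]

theorem permute_inv (A : Matrix (Fin d) (Fin d) ℝ) (π : Equiv.Perm (Fin d)) :
    permute A⁻¹ π = (permute A π)⁻¹ := by
  simp [permute_eq_submatrix, Matrix.inv_submatrix_equiv]

theorem permute_sub (A B : Matrix (Fin d) (Fin d) ℝ) (π : Equiv.Perm (Fin d)) :
    permute (A - B) π = permute A π - permute B π := rfl

theorem permute_transpose (A : Matrix (Fin d) (Fin d) ℝ) (π : Equiv.Perm (Fin d)) :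
    (permute A π)ᵀ = permute Aᵀ π := rfl

theorem permute_one (π : Equiv.Perm (Fin d)) :
    permute (1 : Matrix (Fin d) (Fin d) ℝ) π = 1 := by
  simp [permute_eq_submatrix]

theorem permute_symm_permute (A : Matrix (Fin d) (Fin d) ℝ) (π : Equiv.Perm (Fin d)) :
    permute (permute A π.symm) π = A := by
  ext i j; simp [permute]

theorem det_permute (A : Matrix (Fin d) (Fin d) ℝ) (π : Equiv.Perm (Fin d)) :
    (permute A π).det = A.det := by
  simp [permute_eq_submatrix]

theorem trace_permute (A : Matrix (Fin d) (Fin d) ℝ) (π : Equiv.Perm (Fin d)) :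
    (permute A π).trace = A.trace := by
  simp only [Matrix.trace, permute, Matrix.diag, Matrix.of_apply]
  exact Equiv.sum_comp π fun i => A i i

theorem frobNorm_permute (A : Matrix (Fin d) (Fin d) ℝ) (π : Equiv.Perm (Fin d)) :
    frobNorm (permute A π) = frobNorm A := by
  rw [frobNorm, frobNorm, matInner, matInner, permute_transpose, ← permute_mul, trace_permute]

theorem posDef_permute {A : Matrix (Fin d) (Fin d) ℝ} (hA : A.PosDef) (π : Equiv.Perm (Fin d)) :
    (permute A π).PosDef :=
  hA.submatrix π.injective

/-! ### Diagonalization -/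

theorem exists_orthogonal_diagonal {M : Matrix (Fin d) (Fin d) ℝ} (hM : M.IsHermitian) :
    ∃ (U : Matrix (Fin d) (Fin d) ℝ), Uᵀ * U = 1 ∧ U * Uᵀ = 1 ∧
      M = U * diagonal hM.eigenvalues * Uᵀ := by
  refine ⟨hM.eigenvectorUnitary, ?_, ?_, ?_⟩
  · simpa [star_eq_conjTranspose] using (Unitary.coe_star_mul_self hM.eigenvectorUnitary)
  · simpa [star_eq_conjTranspose] using (Unitary.coe_mul_star_self hM.eigenvectorUnitary)
  · have := hM.spectral_theorem
    rw [Unitary.conjStarAlgAut_apply] at this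
    simpa [star_eq_conjTranspose, Function.comp_def] using this

theorem trace_conj_orthogonal {U : Matrix (Fin d) (Fin d) ℝ} (hU : Uᵀ * U = 1)
    (A : Matrix (Fin d) (Fin d) ℝ) : (U * A * Uᵀ).trace = A.trace := by
  rw [Matrix.trace_mul_comm, ← mul_assoc, hU, one_mul]

theorem frobNorm_sq_conj_diagonal {U : Matrix (Fin d) (Fin d) ℝ} (hU : Uᵀ * U = 1)
    (v : Fin d → ℝ) : frobNorm (U * diagonal v * Uᵀ) ^ 2 = ∑ i, v i ^ 2 := by
  have h : U * diagonal v * Uᵀ * (U * diagonal v * Uᵀ)ᵀ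
      = U * (diagonal v * diagonal v) * Uᵀ := by
    rw [transpose_mul, transpose_mul, transpose_transpose, diagonal_transpose]
    calc _ = U * diagonal v * (Uᵀ * U) * (diagonal v * Uᵀ) := by simp only [mul_assoc]
      _ = _ := by rw [hU]; simp only [mul_assoc, mul_one]
  rw [frobNorm_sq_eq_trace, h, trace_conj_orthogonal hU]
  simp [sq, Matrix.trace]

/-- `k = x - 1 - log x` is nonnegative and `(x - 1)² ≤ 8 k + 4 k²`. -/
theorem sq_sub_one_le {x : ℝ} (hx : 0 < x) :
    0 ≤ x - 1 - Real.log x ∧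
      (x - 1) ^ 2 ≤ 8 * (x - 1 - Real.log x) + 4 * (x - 1 - Real.log x) ^ 2 := by
  have h0 : 0 ≤ x - 1 - Real.log x := by linarith [Real.log_le_sub_one_of_pos hx]
  refine ⟨h0, ?_⟩
  -- Applying `log y ≤ y - 1` at `y = √x` gives `x - 1 - log x ≥ (√x - 1)²`, and `(√x + 1)² ≤ 2 (1 +
  -- x)`.
  have key : (x - 1) ^ 2 ≤ 2 * (1 + x) * (x - 1 - Real.log x) := by
    have hs : 0 < √x := Real.sqrt_pos.2 hx
    have hlog : Real.log x = 2 * Real.log (√x) := by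
      rw [Real.log_sqrt hx.le]; ring
    have h1 := Real.log_le_sub_one_of_pos hs
    have h2 : (√x) ^ 2 = x := Real.sq_sqrt hx.le
    set y := √x
    have h3 : (y - 1) ^ 2 ≤ x - 1 - Real.log x := by rw [hlog, ← h2]; nlinarith
    have h4 : (x - 1) ^ 2 = (y + 1) ^ 2 * (y - 1) ^ 2 := by rw [← h2]; ring
    have h5 : (y + 1) ^ 2 ≤ 2 * (1 + x) := by rw [← h2]; nlinarith [sq_nonneg (y - 1)]
    rw [h4]
    exact mul_le_mul h5 h3 (sq_nonneg _) (by positivity)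
  -- With `k = x - 1 - log x`, `key` reads `(x - 1)² ≤ 4k + 2 (x - 1) k`; the cross term is at most
  -- `(x - 1)² / 2 + 2k²`.
  nlinarith [sq_nonneg ((x - 1) - 2 * (x - 1 - Real.log x))]

/-- Determinant one makes the logarithms of the eigenvalues sum to zero, so the trace equals `∑ (v -
1 - log v)` and the scalar inequality applies to each eigenvalue. -/
theorem frobNorm_sq_sub_one_le {L : Matrix (Fin d) (Fin d) ℝ} (hL : L.PosDef) (hdet : L.det = 1) :
    0 ≤ (L - 1).trace ∧
      frobNorm (L - 1) ^ 2 ≤ 8 * (L - 1).trace + 4 * (L - 1).trace ^ 2 := by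
  obtain ⟨U, hU, hU', hLU⟩ := exists_orthogonal_diagonal hL.1
  set v := hL.1.eigenvalues with hv
  have hpos : ∀ i, 0 < v i := hL.eigenvalues_pos
  have hsub : L - 1 = U * diagonal (fun i => v i - 1) * Uᵀ := by
    have h1 : diagonal (fun i => v i - 1) = diagonal v - (1 : Matrix (Fin d) (Fin d) ℝ) := by
      rw [← diagonal_one, diagonal_sub]
    rw [h1, mul_sub, sub_mul, mul_one, hU', ← hLU]
  have hprod : ∏ i, v i = 1 := by
    rw [← hdet, hL.1.det_eq_prod_eigenvalues]; simp [hv]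
  have hlog : ∑ i, Real.log (v i) = 0 := by
    rw [← Real.log_prod (fun i _ => (hpos i).ne'), hprod, Real.log_one]
  have htr : (L - 1).trace = ∑ i, (v i - 1 - Real.log (v i)) := by
    rw [hsub, trace_conj_orthogonal hU, Finset.sum_sub_distrib, hlog]
    simp [Matrix.trace]
  have hk : ∀ i ∈ Finset.univ, 0 ≤ v i - 1 - Real.log (v i) := fun i _ => (sq_sub_one_le (hpos i)).1
  rw [htr, hsub, frobNorm_sq_conj_diagonal hU]
  refine ⟨Finset.sum_nonneg hk, ?_⟩
  calc ∑ i, (v i - 1) ^ 2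
      ≤ ∑ i, (8 * (v i - 1 - Real.log (v i)) + 4 * (v i - 1 - Real.log (v i)) ^ 2) :=
        Finset.sum_le_sum fun i _ => (sq_sub_one_le (hpos i)).2
    _ ≤ _ := by
        rw [Finset.sum_add_distrib, ← Finset.mul_sum, ← Finset.mul_sum]
        gcongr
        exact Finset.sum_sq_le_sq_sum_of_nonneg hk

/-! ### Standard Gaussian samples -/

/-- The law of `m` independent standard Gaussian vectors of `ℝ^d`. -/
noncomputable def gaussianSample (d m : ℕ) : Measure (Fin m → EuclideanSpace ℝ (Fin d)) :=
  Measure.pi fun _ => stdGaussian (EuclideanSpace ℝ (Fin d))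

instance : IsProbabilityMeasure (gaussianSample d m) := by
  unfold gaussianSample; infer_instance

theorem lintegral_pi_prod {ι α : Type*} [Fintype ι] [MeasurableSpace α] (ν : Measure α)
    [IsProbabilityMeasure ν] (F : ι → α → ENNReal) (hF : ∀ i, Measurable (F i)) :
    ∫⁻ z, ∏ i, F i (z i) ∂(Measure.pi fun _ : ι => ν) = ∏ i, ∫⁻ x, F i x ∂ν := by
  have h := lintegral_prod_eq_prod_lintegral_of_indepFun (μ := Measure.pi fun _ : ι => ν)
    Finset.univ (fun i z => F i (z i))
    (iIndepFun_pi (μ := fun _ : ι => ν) (X := F) fun i => (hF i).aemeasurable)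
    (fun i => (hF i).comp (measurable_pi_apply i))
  rw [h]
  refine Finset.prod_congr rfl fun i _ => ?_
  exact (measurePreserving_eval (fun _ : ι => ν) i).lintegral_comp (hF i)

theorem lintegral_exp_inner_stdGaussian (g : EuclideanSpace ℝ (Fin d)) :
    ∫⁻ x, ENNReal.ofReal (Real.exp (inner ℝ g x)) ∂(stdGaussian (EuclideanSpace ℝ (Fin d)))
      = ENNReal.ofReal (Real.exp (‖g‖ ^ 2 / 2)) := by
  set L : StrongDual ℝ (EuclideanSpace ℝ (Fin d)) := innerSL ℝ g with hL
  have hlaw : (stdGaussian (EuclideanSpace ℝ (Fin d))).map L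
      = gaussianReal 0 (‖g‖ ^ 2).toNNReal := by
    rw [IsGaussian.map_eq_gaussianReal, variance_dual_stdGaussian,
      integral_strongDual_stdGaussian, hL, innerSL_apply_norm]
  have hint : Integrable (fun x : ℝ => Real.exp (1 * x)) (gaussianReal 0 (‖g‖ ^ 2).toNNReal) :=
    integrable_exp_mul_gaussianReal 1
  have hmgf : ∫ x, Real.exp (1 * x) ∂(gaussianReal 0 (‖g‖ ^ 2).toNNReal)
      = Real.exp (‖g‖ ^ 2 / 2) := by
    have := congrFun (mgf_id_gaussianReal (μ := 0) (v := (‖g‖ ^ 2).toNNReal)) 1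
    simpa [mgf, Real.coe_toNNReal _ (sq_nonneg ‖g‖)] using this
  have h1 : ∫⁻ x, ENNReal.ofReal (Real.exp (inner ℝ g x))
      ∂(stdGaussian (EuclideanSpace ℝ (Fin d)))
      = ∫⁻ x, ENNReal.ofReal (Real.exp (1 * x))
        ∂((stdGaussian (EuclideanSpace ℝ (Fin d))).map L) := by
    rw [lintegral_map (by fun_prop) (by fun_prop)]
    simp [hL]
  rw [h1, hlaw, ← ofReal_integral_eq_lintegral_ofReal hint
    (Filter.Eventually.of_forall fun _ => (Real.exp_pos _).le), hmgf]

theorem lintegral_exp_sum_inner (g : Fin m → EuclideanSpace ℝ (Fin d)) :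
    ∫⁻ z, ENNReal.ofReal (Real.exp (∑ k, inner ℝ (g k) (z k))) ∂(gaussianSample d m)
      = ENNReal.ofReal (Real.exp ((∑ k, ‖g k‖ ^ 2) / 2)) := by
  have h := lintegral_pi_prod (stdGaussian (EuclideanSpace ℝ (Fin d)))
    (fun (k : Fin m) x => ENNReal.ofReal (Real.exp (inner ℝ (g k) x))) (fun k => by fun_prop)
  simp_rw [← ENNReal.ofReal_prod_of_nonneg (fun i _ => (Real.exp_pos _).le), ← Real.exp_sum,
    lintegral_exp_inner_stdGaussian] at h
  rw [← ENNReal.ofReal_prod_of_nonneg (fun i _ => (Real.exp_pos _).le), ← Real.exp_sum,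
    ← Finset.sum_div] at h
  exact h

/-! ### Linear images -/

/-- Apply the linear map with matrix `A` to every vector of a sample. -/
noncomputable def mulSample (A : Matrix (Fin d) (Fin d) ℝ) (z : Fin m → EuclideanSpace ℝ (Fin d)) :
    Fin m → EuclideanSpace ℝ (Fin d) :=
  fun k => Matrix.toEuclideanCLM (n := Fin d) (𝕜 := ℝ) A (z k)

theorem mulSample_apply (A : Matrix (Fin d) (Fin d) ℝ) (z : Fin m → EuclideanSpace ℝ (Fin d))
    (k : Fin m) (i : Fin d) : mulSample A z k i = ∑ j, A i j * z k j := by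
  simp [mulSample, Matrix.ofLp_toEuclideanCLM, Matrix.mulVec, dotProduct]

theorem sampleCov_mulSample (A : Matrix (Fin d) (Fin d) ℝ)
    (z : Fin m → EuclideanSpace ℝ (Fin d)) :
    sampleCov (mulSample A z) = A * sampleCov z * Aᵀ := by
  ext i j
  simp only [sampleCov, Matrix.of_apply, mulSample_apply, Matrix.mul_apply, Matrix.transpose_apply,
    Finset.sum_div, Finset.sum_mul, Finset.mul_sum]
  rw [Finset.sum_comm' (t' := Finset.univ) (s' := fun _ => Finset.univ) (by simp)]
  refine Finset.sum_congr rfl fun a _ => ?_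
  rw [Finset.sum_comm]
  refine Finset.sum_congr rfl fun b _ => Finset.sum_congr rfl fun k _ => ?_
  ring

theorem sampleCov_transpose (z : Fin m → EuclideanSpace ℝ (Fin d)) :
    (sampleCov z)ᵀ = sampleCov z := by
  ext i j; simp [sampleCov, mul_comm]

theorem map_toEuclideanCLM_stdGaussian {U : Matrix (Fin d) (Fin d) ℝ} (hU : U * Uᵀ = 1) :
    (stdGaussian (EuclideanSpace ℝ (Fin d))).map (Matrix.toEuclideanCLM (n := Fin d) (𝕜 := ℝ) U)
      = stdGaussian (EuclideanSpace ℝ (Fin d)) := by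
  have hU' : Uᵀ * U = 1 := mul_eq_one_comm.1 hU
  let e : EuclideanSpace ℝ (Fin d) ≃ₗᵢ[ℝ] EuclideanSpace ℝ (Fin d) :=
    { toLinearEquiv := LinearEquiv.ofLinearMap
        (Matrix.toEuclideanCLM (n := Fin d) (𝕜 := ℝ) U).toLinearMap
        (Matrix.toEuclideanCLM (n := Fin d) (𝕜 := ℝ) Uᵀ).toLinearMap
        (by
          ext1 x
          change (Matrix.toEuclideanCLM (n := Fin d) (𝕜 := ℝ) U
            * Matrix.toEuclideanCLM (n := Fin d) (𝕜 := ℝ) Uᵀ) x = x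
          rw [← map_mul, hU, map_one]; rfl)
        (by
          ext1 x
          change (Matrix.toEuclideanCLM (n := Fin d) (𝕜 := ℝ) Uᵀ
            * Matrix.toEuclideanCLM (n := Fin d) (𝕜 := ℝ) U) x = x
          rw [← map_mul, hU', map_one]; rfl)
      norm_map' := fun x => by
        change ‖Matrix.toEuclideanCLM (n := Fin d) (𝕜 := ℝ) U x‖ = ‖x‖
        rw [← sq_eq_sq₀ (norm_nonneg _) (norm_nonneg _), ← real_inner_self_eq_norm_sq,
          ← real_inner_self_eq_norm_sq]
        simp only [Matrix.ofLp_toEuclideanCLM,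
          EuclideanSpace.inner_eq_star_dotProduct, star_trivial]
        rw [Matrix.dotProduct_mulVec, ← Matrix.mulVec_transpose, Matrix.mulVec_mulVec, hU',
          Matrix.one_mulVec] }
  exact stdGaussian_map e

theorem measurePreserving_mulSample {U : Matrix (Fin d) (Fin d) ℝ} (hU : U * Uᵀ = 1) :
    MeasurePreserving (mulSample (m := m) U) (gaussianSample d m) (gaussianSample d m) :=
  measurePreserving_pi _ _ fun _ => ⟨by fun_prop, map_toEuclideanCLM_stdGaussian hU⟩

/-- A position on the arc and the velocity there are again independent standard Gaussian samples;
this is what the Maurey–Pisier argument rests on. -/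
theorem measurePreserving_rotation (θ : ℝ) :
    MeasurePreserving (fun p : (Fin m → EuclideanSpace ℝ (Fin d)) ×
        (Fin m → EuclideanSpace ℝ (Fin d)) =>
        (Real.cos θ • p.1 + Real.sin θ • p.2, -Real.sin θ • p.1 + Real.cos θ • p.2))
      ((gaussianSample d m).prod (gaussianSample d m))
      ((gaussianSample d m).prod (gaussianSample d m)) := by
  set ν := stdGaussian (EuclideanSpace ℝ (Fin d))
  have h0 : MeasurePreserving (ContinuousLinearMap.rotation (E := EuclideanSpace ℝ (Fin d)) θ)
      (ν.prod ν) (ν.prod ν) :=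
    ⟨by fun_prop, IsGaussian.map_rotation_eq_self_of_forall_strongDual_eq_zero
      integral_strongDual_stdGaussian θ⟩
  have h1 := measurePreserving_pi (fun _ : Fin m => ν.prod ν) (fun _ : Fin m => ν.prod ν)
    (fun _ => h0)
  have h2 := measurePreserving_arrowProdEquivProdArrow (EuclideanSpace ℝ (Fin d))
    (EuclideanSpace ℝ (Fin d)) (Fin m) (fun _ => ν) (fun _ => ν)
  exact (h2.comp h1).comp h2.symm

/-! ### Exponential moments of quadratic forms -/

/-- The left side is the exact moment generating function of a centred `χ²₁` variable. The
first-order remainder of `log (1 - 2a)` is at most `8a²`, and half of it enters the exponent. -/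
theorem inv_sqrt_one_sub_le {a : ℝ} (ha : |a| ≤ 1 / 4) :
    Real.exp (-a) * √((1 - 2 * a)⁻¹) ≤ Real.exp (4 * a ^ 2) := by
  have ha' := abs_le.1 ha
  have hpos : 0 < 1 - 2 * a := by linarith
  have habs : |2 * a| < 1 := by rw [abs_mul, abs_two]; linarith
  have h := Real.abs_log_sub_add_sum_range_le habs 1
  simp only [Finset.sum_range_one, zero_add, pow_one, Nat.cast_zero, div_one] at h
  have h2 : |2 * a| ^ (1 + 1) / (1 - |2 * a|) ≤ 8 * a ^ 2 := by
    have h3 : |2 * a| ≤ 1 / 2 := by rw [abs_mul, abs_two]; linarith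
    rw [div_le_iff₀ (by linarith), show 1 + 1 = 2 from rfl, sq_abs]
    nlinarith [sq_nonneg a]
  have h4 := neg_le_of_abs_le (h.trans h2)
  have h5 : √((1 - 2 * a)⁻¹) = Real.exp (-(Real.log (1 - 2 * a)) / 2) := by
    rw [Real.sqrt_eq_rpow, Real.rpow_def_of_pos (inv_pos.2 hpos), Real.log_inv]
    ring_nf
  rw [h5, ← Real.exp_add]
  exact Real.exp_le_exp.2 (by linarith)

theorem lintegral_exp_sq_gaussianReal_le {a : ℝ} (ha : |a| ≤ 1 / 4) :
    ∫⁻ x, ENNReal.ofReal (Real.exp (a * (x ^ 2 - 1))) ∂(gaussianReal 0 1)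
      ≤ ENNReal.ofReal (Real.exp (4 * a ^ 2)) := by
  have ha' := abs_le.1 ha
  have hb : 0 < 1 / 2 - a := by linarith
  have h1 : ∀ x : ℝ, gaussianPDF 0 1 x * ENNReal.ofReal (Real.exp (a * (x ^ 2 - 1)))
      = ENNReal.ofReal ((√(2 * Real.pi))⁻¹ * Real.exp (-a) *
          Real.exp (-(1 / 2 - a) * x ^ 2)) := by
    intro x
    rw [gaussianPDF, ← ENNReal.ofReal_mul (gaussianPDFReal_nonneg _ _ _), gaussianPDFReal]
    congr 1
    simp only [NNReal.coe_one, mul_one, sub_zero]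
    rw [mul_assoc, mul_assoc, ← Real.exp_add, ← Real.exp_add]
    congr 2
    ring
  rw [gaussianReal_of_var_ne_zero _ one_ne_zero,
    lintegral_withDensity_eq_lintegral_mul _ (measurable_gaussianPDF 0 1) (by fun_prop)]
  simp only [Pi.mul_apply, h1]
  rw [← ofReal_integral_eq_lintegral_ofReal ((integrable_exp_neg_mul_sq hb).const_mul _)
    (Filter.Eventually.of_forall fun _ => by positivity), integral_const_mul, integral_gaussian]
  refine ENNReal.ofReal_le_ofReal (le_trans (le_of_eq ?_) (inv_sqrt_one_sub_le ha))
  have h2 : Real.pi / (1 / 2 - a) = 2 * Real.pi * (1 - 2 * a)⁻¹ := by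
    have : (1 - 2 * a) ≠ 0 := by linarith
    have : (1 / 2 - a) ≠ 0 := hb.ne'
    field_simp
  rw [h2, Real.sqrt_mul (x := 2 * Real.pi) (by positivity)]
  have h3 : √(2 * Real.pi) ≠ 0 := by positivity
  generalize √(2 * Real.pi) = u at h3
  generalize √((1 - 2 * a)⁻¹) = w
  field_simp

theorem lintegral_exp_diag_stdGaussian_le (v : Fin d → ℝ) (hv : ∀ i, |v i| ≤ 1 / 4) :
    ∫⁻ x, ENNReal.ofReal (Real.exp (∑ i, v i * (x i ^ 2 - 1)))
        ∂(stdGaussian (EuclideanSpace ℝ (Fin d)))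
      ≤ ENNReal.ofReal (Real.exp (4 * ∑ i, v i ^ 2)) := by
  rw [← map_pi_eq_stdGaussian, lintegral_map (by fun_prop) (by fun_prop)]
  have h := lintegral_pi_prod (gaussianReal 0 1)
    (fun (i : Fin d) x => ENNReal.ofReal (Real.exp (v i * (x ^ 2 - 1)))) (fun k => by fun_prop)
  simp_rw [← ENNReal.ofReal_prod_of_nonneg (fun i _ => (Real.exp_pos _).le), ← Real.exp_sum] at h
  refine h.le.trans ?_
  rw [Finset.mul_sum, Real.exp_sum, ENNReal.ofReal_prod_of_nonneg (fun i _ => (Real.exp_pos _).le)]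
  exact Finset.prod_le_prod' fun i _ => lintegral_exp_sq_gaussianReal_le (hv i)

theorem lintegral_exp_diag_gaussianSample_le (v : Fin d → ℝ) (hv : ∀ i, |v i| ≤ 1 / 4) :
    ∫⁻ z, ENNReal.ofReal (Real.exp (∑ k, ∑ i, v i * (z k i ^ 2 - 1))) ∂(gaussianSample d m)
      ≤ ENNReal.ofReal (Real.exp (4 * m * ∑ i, v i ^ 2)) := by
  have h := lintegral_pi_prod (stdGaussian (EuclideanSpace ℝ (Fin d)))
    (fun (_ : Fin m) x => ENNReal.ofReal (Real.exp (∑ i, v i * (x i ^ 2 - 1))))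
    (fun k => by fun_prop)
  simp_rw [← ENNReal.ofReal_prod_of_nonneg (fun i _ => (Real.exp_pos _).le), ← Real.exp_sum] at h
  refine h.le.trans ?_
  have h2 : (4 * m * ∑ i, v i ^ 2) = ∑ _k : Fin m, 4 * ∑ i, v i ^ 2 := by simp; ring
  rw [h2, Real.exp_sum, ENNReal.ofReal_prod_of_nonneg (fun i _ => (Real.exp_pos _).le)]
  exact Finset.prod_le_prod' fun i _ => lintegral_exp_diag_stdGaussian_le v hv

/-! ### Concentration of linear functionals of the sample covariance -/

theorem measure_le_of_lintegral_exp_le {α : Type*} [MeasurableSpace α] {μ : Measure α} {f : α → ℝ}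
    (hf : Measurable f) {a b : ℝ}
    (h : ∫⁻ x, ENNReal.ofReal (Real.exp (f x)) ∂μ ≤ ENNReal.ofReal (Real.exp b)) :
    μ {x | a ≤ f x} ≤ ENNReal.ofReal (Real.exp (b - a)) := by
  have h1 := mul_meas_ge_le_lintegral (μ := μ) (f := fun x => ENNReal.ofReal (Real.exp (f x)))
    (by fun_prop) (ENNReal.ofReal (Real.exp a))
  have h2 : {x | a ≤ f x}
      = {x | ENNReal.ofReal (Real.exp a) ≤ ENNReal.ofReal (Real.exp (f x))} := by
    ext x
    simp [ENNReal.ofReal_le_ofReal_iff (Real.exp_pos _).le]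
  have hpos : ENNReal.ofReal (Real.exp a) ≠ 0 := by simp [Real.exp_pos]
  rw [h2, Real.exp_sub, ENNReal.ofReal_div_of_pos (Real.exp_pos _),
    ENNReal.le_div_iff_mul_le (Or.inl hpos) (Or.inl ENNReal.ofReal_ne_top), mul_comm]
  exact h1.trans h

theorem continuous_sampleCov :
    Continuous (sampleCov : (Fin m → EuclideanSpace ℝ (Fin d)) → Matrix (Fin d) (Fin d) ℝ) := by
  refine continuous_matrix fun i j => ?_
  simp only [sampleCov, Matrix.of_apply]
  fun_prop

theorem measurable_trace_mul_sampleCov (M : Matrix (Fin d) (Fin d) ℝ) :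
    Measurable fun z : Fin m → EuclideanSpace ℝ (Fin d) => (M * (sampleCov z - 1)).trace :=
  Continuous.measurable (by have := continuous_sampleCov (d := d) (m := m); fun_prop)

theorem trace_mul_sampleCov_conj {U : Matrix (Fin d) (Fin d) ℝ} (hU : Uᵀ * U = 1)
    (v : Fin d → ℝ) (hm : 0 < m) (z : Fin m → EuclideanSpace ℝ (Fin d)) :
    m * (U * diagonal v * Uᵀ * (sampleCov z - 1)).trace
      = ∑ k, ∑ i, v i * (mulSample Uᵀ z k i ^ 2 - 1) := by
  have hm' : (m : ℝ) ≠ 0 := by positivity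
  have h1 : (U * diagonal v * Uᵀ * (sampleCov z - 1)).trace
      = (diagonal v * (sampleCov (mulSample Uᵀ z) - 1)).trace := by
    rw [sampleCov_mulSample, transpose_transpose]
    have : Uᵀ * sampleCov z * U - 1 = Uᵀ * (sampleCov z - 1) * U := by
      rw [mul_sub, sub_mul, mul_one, hU]
    rw [this, mul_assoc, mul_assoc, trace_mul_comm, ← mul_assoc, ← mul_assoc]
    simp only [mul_assoc]
  rw [h1]
  simp only [Matrix.trace, Matrix.diag, Matrix.diagonal_mul, Matrix.sub_apply, sampleCov,
    Matrix.of_apply, Matrix.one_apply_eq]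
  rw [Finset.mul_sum, Finset.sum_comm]
  refine Finset.sum_congr rfl fun i _ => ?_
  rw [← Finset.mul_sum, Finset.sum_sub_distrib]
  simp only [Finset.sum_const, Finset.card_univ, Fintype.card_fin, nsmul_eq_mul, mul_one, sq]
  field_simp

/-- Rotation invariance diagonalizes `M`, leaving a sum of independent centred `χ²₁` variables
weighted by the eigenvalues, each of which is at most `frobNorm M` in absolute value. -/
theorem lintegral_exp_trace_le {M : Matrix (Fin d) (Fin d) ℝ} (hM : M.IsHermitian) {s : ℝ}
    (hs : 0 ≤ s) (hsM : s * frobNorm M ≤ 1 / 4) (hm : 0 < m) :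
    ∫⁻ z, ENNReal.ofReal (Real.exp (s * (m * (M * (sampleCov z - 1)).trace)))
        ∂(gaussianSample d m)
      ≤ ENNReal.ofReal (Real.exp (4 * m * (s ^ 2 * frobNorm M ^ 2))) := by
  obtain ⟨U, hU, hU', hMU⟩ := exists_orthogonal_diagonal hM
  set v := hM.eigenvalues
  have hfr : frobNorm M ^ 2 = ∑ i, v i ^ 2 := by
    conv_lhs => rw [hMU]
    exact frobNorm_sq_conj_diagonal hU v
  have hv : ∀ i, |s * v i| ≤ 1 / 4 := by
    intro i
    rw [abs_mul, abs_of_nonneg hs]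
    refine le_trans (mul_le_mul_of_nonneg_left ?_ hs) hsM
    rw [← sq_le_sq₀ (abs_nonneg _) (frobNorm_nonneg _), sq_abs, hfr]
    exact Finset.single_le_sum (f := fun i => v i ^ 2) (fun i _ => sq_nonneg _) (Finset.mem_univ i)
  have h1 : ∀ z : Fin m → EuclideanSpace ℝ (Fin d),
      s * (m * (M * (sampleCov z - 1)).trace)
        = ∑ k, ∑ i, (s * v i) * (mulSample Uᵀ z k i ^ 2 - 1) := by
    intro z
    conv_lhs => rw [hMU]
    rw [trace_mul_sampleCov_conj hU v hm, Finset.mul_sum]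
    simp only [Finset.mul_sum, mul_assoc]
  simp_rw [h1]
  have h2 := (measurePreserving_mulSample (d := d) (m := m) (U := Uᵀ)
    (by rwa [transpose_transpose])).lintegral_comp
    (f := fun z => ENNReal.ofReal (Real.exp (∑ k, ∑ i, (s * v i) * (z k i ^ 2 - 1))))
    (by fun_prop)
  rw [h2]
  refine (lintegral_exp_diag_gaussianSample_le _ hv).trans (le_of_eq ?_)
  rw [hfr, Finset.mul_sum (a := s ^ 2)]
  simp only [mul_pow]

/-- Bernstein's inequality for the sample covariance in a fixed direction. -/
theorem measure_lt_trace_mul_sampleCov_sub_one_le (M : Matrix (Fin d) (Fin d) ℝ) (hm : 0 < m)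
    {t : ℝ} (ht : 0 ≤ t) (htm : t ≤ m) :
    gaussianSample d m {z | 5 * frobNorm M * √(t / m) < (M * (sampleCov z - 1)).trace}
      ≤ ENNReal.ofReal (Real.exp (-t)) := by
  have hm' : (0 : ℝ) < m := by positivity
  rcases (frobNorm_nonneg M).eq_or_lt with h0 | h0
  · have : {z : Fin m → EuclideanSpace ℝ (Fin d) |
        5 * frobNorm M * √(t / m) < (M * (sampleCov z - 1)).trace} = ∅ := by
      ext z
      have := (le_abs_self _).trans (abs_trace_mul_le M (sampleCov z - 1))
      rw [← h0] at this ⊢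
      simpa using this
    rw [this]; simp
  set a := frobNorm M
  set N := (1 / 2 : ℝ) • (M + Mᵀ) with hN
  have hNH : N.IsHermitian := by
    rw [Matrix.IsHermitian, Matrix.conjTranspose_eq_transpose_of_trivial, hN, transpose_smul,
      transpose_add, transpose_transpose, add_comm]
  have hNa : frobNorm N ≤ a := by
    have h1 : N = (1 / 2 : ℝ) • M + ((1 / 2 : ℝ) • M)ᵀ := by rw [hN, smul_add, transpose_smul]
    have h2 : frobNorm ((1 / 2 : ℝ) • M) = (1 / 2) * a := by
      rw [← sq_eq_sq₀ (frobNorm_nonneg _) (by positivity), mul_pow, frobNorm_sq, frobNorm_sq,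
        Finset.mul_sum]
      refine Finset.sum_congr rfl fun i _ => ?_
      rw [Finset.mul_sum]
      simp [mul_pow]
    rw [h1]
    refine (frobNorm_add_le _ _).trans (le_of_eq ?_)
    rw [frobNorm_transpose, h2]; ring
  have htr : ∀ z : Fin m → EuclideanSpace ℝ (Fin d),
      (M * (sampleCov z - 1)).trace = (N * (sampleCov z - 1)).trace := by
    intro z
    have h1 : (Mᵀ * (sampleCov z - 1)).trace = (M * (sampleCov z - 1)).trace := by
      rw [← trace_transpose, transpose_mul, transpose_sub, sampleCov_transpose, transpose_one,
        transpose_transpose, trace_mul_comm]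
    rw [hN, smul_mul_assoc, trace_smul, add_mul, trace_add, h1, smul_eq_mul]; ring
  set r := √(t / m) with hr
  have hr2 : m * r ^ 2 = t := by
    rw [hr, Real.sq_sqrt (by positivity)]; field_simp
  have hr1 : r ≤ 1 := by
    exact Real.sqrt_le_one.2 ((div_le_one hm').2 htm)
  have hr0 : 0 ≤ r := Real.sqrt_nonneg _
  -- This gives `s a = r / 4 ≤ 1 / 4`, where `t ≤ m` is used. The exponent is then at most `t / 4`
  -- against the threshold `5t / 4`.
  set s := r / (4 * a) with hs
  have hsa : s * a = r / 4 := by rw [hs]; field_simp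
  have hs0 : 0 ≤ s := by positivity
  have hmgf := lintegral_exp_trace_le (m := m) hNH hs0
    ((mul_le_mul_of_nonneg_left hNa hs0).trans (by rw [hsa]; linarith)) hm
  have hmeas : Measurable fun z : Fin m → EuclideanSpace ℝ (Fin d) =>
      s * (m * (N * (sampleCov z - 1)).trace) :=
    ((measurable_trace_mul_sampleCov N).const_mul _).const_mul _
  have hbound := measure_le_of_lintegral_exp_le hmeas (a := s * (m * (5 * a * r))) hmgf
  refine (measure_mono ?_).trans (hbound.trans (ENNReal.ofReal_le_ofReal (Real.exp_le_exp.2 ?_)))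
  · intro z hz
    rw [Set.mem_ofPred_eq, htr] at hz
    exact mul_le_mul_of_nonneg_left (mul_le_mul_of_nonneg_left hz.le hm'.le) hs0
  · have h1 : s ^ 2 * frobNorm N ^ 2 ≤ (r / 4) ^ 2 := by
      rw [← hsa, mul_pow]
      exact mul_le_mul_of_nonneg_left (pow_le_pow_left₀ (frobNorm_nonneg _) hNa 2) (sq_nonneg _)
    have h2 : s * (m * (5 * a * r)) = 5 / 4 * t := by
      rw [← hr2]; linear_combination 5 * m * r * hsa
    have h3 : 4 * m * (s ^ 2 * frobNorm N ^ 2) ≤ 4 * m * (r / 4) ^ 2 :=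
      mul_le_mul_of_nonneg_left h1 (by positivity)
    rw [h2]
    linarith

/-! ### Operator norm of the sample covariance -/

/-- A `1/2`-separated subset of the unit ball of maximal cardinality is a net. Dilated by two it is
`1`-separated in the ball of radius two, where the Besicovitch packing bound is `5 ^ d`. -/
theorem exists_half_net (d : ℕ) : ∃ N : Finset (EuclideanSpace ℝ (Fin d)),
    N.card ≤ 5 ^ d ∧ (∀ x ∈ N, ‖x‖ ≤ 1) ∧ ∀ x, ‖x‖ ≤ 1 → ∃ y ∈ N, ‖x - y‖ ≤ 1 / 2 := by
  classical
  let Q : Finset (EuclideanSpace ℝ (Fin d)) → Prop := fun s =>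
    (∀ c ∈ s, ‖c‖ ≤ 1) ∧ ∀ c ∈ s, ∀ e ∈ s, c ≠ e → 1 / 2 ≤ ‖c - e‖
  have hcard : ∀ s, Q s → s.card ≤ 5 ^ d := by
    intro s hs
    have hinj : Function.Injective fun x : EuclideanSpace ℝ (Fin d) => (2 : ℝ) • x :=
      smul_right_injective _ two_ne_zero
    have h := Besicovitch.card_le_of_separated (s.image fun x => (2 : ℝ) • x) ?_ ?_
    · rwa [Finset.card_image_of_injective _ hinj, finrank_euclideanSpace_fin] at h
    · intro c hc
      obtain ⟨x, hx, rfl⟩ := Finset.mem_image.1 hc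
      rw [norm_smul, Real.norm_two]
      linarith [hs.1 x hx]
    · intro c hc e he hce
      obtain ⟨x, hx, rfl⟩ := Finset.mem_image.1 hc
      obtain ⟨y, hy, rfl⟩ := Finset.mem_image.1 he
      have hxy : x ≠ y := fun h => hce (by rw [h])
      rw [← smul_sub, norm_smul, Real.norm_two]
      linarith [hs.2 x hx y hy hxy]
  have hne : (Finset.card '' {s | Q s}).Nonempty := ⟨0, ∅, by simp [Q], rfl⟩
  have hbdd : BddAbove (Finset.card '' {s | Q s}) :=
    ⟨5 ^ d, by rintro _ ⟨s, hs, rfl⟩; exact hcard s hs⟩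
  obtain ⟨s, hs, hsmax⟩ := Nat.sSup_mem hne hbdd
  refine ⟨s, hcard s hs, hs.1, fun x hx => ?_⟩
  by_contra! hcon
  have hxs : x ∉ s := fun h => by
    have := hcon x h
    simp at this
    linarith
  have hQ : Q (insert x s) := by
    refine ⟨fun c hc => ?_, fun c hc e he hce => ?_⟩
    · rcases Finset.mem_insert.1 hc with rfl | hc
      exacts [hx, hs.1 c hc]
    · rcases Finset.mem_insert.1 hc with hc' | hc' <;>
        rcases Finset.mem_insert.1 he with he' | he'
      · exact absurd (hc'.trans he'.symm) hce
      · rw [hc']; exact (hcon e he').le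
      · rw [he', norm_sub_rev]; exact (hcon c hc').le
      · exact hs.2 c hc' e he' hce
  have h1 := le_csSup hbdd ⟨_, hQ, rfl⟩
  rw [← hsmax, Finset.card_insert_of_notMem hxs] at h1
  omega

/-- Replacing `w / ‖w‖` by a net point costs at most `‖w‖ / 2`, which is absorbed on the left. -/
theorem norm_le_of_half_net {N : Finset (EuclideanSpace ℝ (Fin d))}
    (hN : ∀ x, ‖x‖ ≤ 1 → ∃ y ∈ N, ‖x - y‖ ≤ 1 / 2) {b : ℝ} (hb : 0 ≤ b)
    (w : EuclideanSpace ℝ (Fin d)) (hw : ∀ y ∈ N, inner ℝ y w ≤ b) : ‖w‖ ≤ 2 * b := by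
  rcases eq_or_ne w 0 with rfl | hw0
  · simpa using hb
  have hpos : 0 < ‖w‖ := norm_pos_iff.2 hw0
  obtain ⟨y, hy, hyw⟩ := hN (‖w‖⁻¹ • w) (by rw [norm_smul, norm_inv, norm_norm]; field_simp; rfl)
  have h1 : inner ℝ (‖w‖⁻¹ • w) w = ‖w‖ := by
    rw [real_inner_smul_left, real_inner_self_eq_norm_sq]; field_simp
  have h2 : inner ℝ (‖w‖⁻¹ • w) w = inner ℝ y w + inner ℝ (‖w‖⁻¹ • w - y) w := by
    rw [inner_sub_left]; ring
  have h3 := (real_inner_le_norm (‖w‖⁻¹ • w - y) w).trans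
    (mul_le_mul_of_nonneg_right hyw hpos.le)
  linarith [hw y hy]

/-- Discretizing each of the two arguments of the bilinear form costs a factor two. -/
theorem l2_opNorm_le_of_half_net {N : Finset (EuclideanSpace ℝ (Fin d))}
    (hN : ∀ x, ‖x‖ ≤ 1 → ∃ y ∈ N, ‖x - y‖ ≤ 1 / 2) {b : ℝ} (hb : 0 ≤ b)
    (E : Matrix (Fin d) (Fin d) ℝ)
    (hE : ∀ x ∈ N, ∀ y ∈ N, inner ℝ x (Matrix.toEuclideanCLM (n := Fin d) (𝕜 := ℝ) E y) ≤ b) :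
    ‖E‖ ≤ 4 * b := by
  rw [Matrix.cstar_norm_def]
  set T := Matrix.toEuclideanCLM (n := Fin d) (𝕜 := ℝ) E
  have h1 : ∀ y ∈ N, ‖T y‖ ≤ 2 * b := fun y hy =>
    norm_le_of_half_net hN hb (T y) fun x hx => hE x hx y hy
  have h2 : ‖T‖ ≤ 2 * b + 1 / 2 * ‖T‖ := by
    refine ContinuousLinearMap.opNorm_le_bound _ (by positivity) fun x => ?_
    rcases eq_or_ne x 0 with rfl | hx0
    · simp
    have hpos : 0 < ‖x‖ := norm_pos_iff.2 hx0
    obtain ⟨y, hy, hyx⟩ := hN (‖x‖⁻¹ • x)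
      (by rw [norm_smul, norm_inv, norm_norm]; field_simp; rfl)
    have h3 : ‖T (‖x‖⁻¹ • x)‖ ≤ 2 * b + 1 / 2 * ‖T‖ := by
      have h4 : T (‖x‖⁻¹ • x) = T y + T (‖x‖⁻¹ • x - y) := by rw [map_sub]; abel
      rw [h4]
      refine (norm_add_le _ _).trans (add_le_add (h1 y hy) ((T.le_opNorm _).trans ?_))
      rw [mul_comm]
      exact mul_le_mul_of_nonneg_right hyx (norm_nonneg _)
    rw [map_smul, norm_smul, norm_inv, norm_norm, inv_mul_le_iff₀ hpos] at h3
    linarith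
  linarith

/-- The sample covariance of standard Gaussian vectors is close to the identity. -/
theorem measure_lt_norm_sampleCov_sub_one_le {t : ℝ} (ht : 0 ≤ t) (hm : 0 < m)
    (htm : 4 * (d + t) ≤ m) :
    gaussianSample d m {z | 40 * √((d + t) / m) < ‖sampleCov z - 1‖}
      ≤ ENNReal.ofReal (Real.exp (-t)) := by
  obtain ⟨N, hNcard, hN1, hN⟩ := exists_half_net d
  have hm' : (0 : ℝ) < m := by positivity
  -- The rank-one matrix `y xᵀ` turns `⟨x, E y⟩` into a trace, and its Frobenius norm is `‖x‖ ‖y‖`.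
  let M : EuclideanSpace ℝ (Fin d) × EuclideanSpace ℝ (Fin d) → Matrix (Fin d) (Fin d) ℝ :=
    fun p => Matrix.of fun i j => p.2 i * p.1 j
  have hMtr : ∀ p (E : Matrix (Fin d) (Fin d) ℝ),
      inner ℝ p.1 (Matrix.toEuclideanCLM (n := Fin d) (𝕜 := ℝ) E p.2) = (M p * E).trace := by
    intro p E
    rw [Matrix.inner_toEuclideanCLM]
    simp only [dotProduct, Matrix.mulVec, Matrix.trace, Matrix.diag, Matrix.mul_apply, M,
      Matrix.of_apply, Finset.mul_sum]
    rw [Finset.sum_comm]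
    refine Finset.sum_congr rfl fun i _ => Finset.sum_congr rfl fun j _ => ?_
    ring
  have hMfr : ∀ p ∈ N ×ˢ N, frobNorm (M p) ≤ 1 := by
    intro p hp
    obtain ⟨hp1, hp2⟩ := Finset.mem_product.1 hp
    rw [← sq_le_sq₀ (frobNorm_nonneg _) zero_le_one, frobNorm_sq]
    have : ∑ i, ∑ j, M p i j ^ 2 = ‖p.2‖ ^ 2 * ‖p.1‖ ^ 2 := by
      rw [EuclideanSpace.real_norm_sq_eq, EuclideanSpace.real_norm_sq_eq, Finset.sum_mul_sum]
      simp [M, mul_pow]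
    rw [this, one_pow]
    exact mul_le_one₀ (pow_le_one₀ (norm_nonneg _) (hN1 _ hp2)) (sq_nonneg _)
      (pow_le_one₀ (norm_nonneg _) (hN1 _ hp1))
  have hsub : {z : Fin m → EuclideanSpace ℝ (Fin d) | 40 * √((d + t) / m) < ‖sampleCov z - 1‖}
      ⊆ ⋃ p ∈ N ×ˢ N, {z | 5 * frobNorm (M p) * √(4 * (d + t) / m)
          < (M p * (sampleCov z - 1)).trace} := by
    intro z hz
    by_contra hcon
    simp only [Set.mem_iUnion, Set.mem_ofPred_eq, not_exists, not_lt] at hcon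
    have hsq : √(4 * (d + t) / m) = 2 * √((d + t) / m) := by
      rw [mul_div_assoc, Real.sqrt_mul (by norm_num), show (4 : ℝ) = 2 ^ 2 by norm_num,
        Real.sqrt_sq (by norm_num)]
    have h1 := l2_opNorm_le_of_half_net hN (b := 10 * √((d + t) / m)) (by positivity)
      (sampleCov z - 1) fun x hx y hy => by
        have hxy : (x, y) ∈ N ×ˢ N := Finset.mem_product.2 ⟨hx, hy⟩
        rw [hMtr (x, y)]
        refine (hcon (x, y) hxy).trans ?_
        rw [hsq]
        have := mul_le_mul_of_nonneg_right (hMfr _ hxy) (Real.sqrt_nonneg ((d + t) / m))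
        linarith
    have hz' : 40 * √((d + t) / m) < ‖sampleCov z - 1‖ := hz
    linarith
  refine (measure_mono hsub).trans ((measure_biUnion_finset_le _ _).trans ?_)
  -- The level `4 (d + t)` pays for the at most `25 ^ d ≤ exp (4 d)` pairs of net points.
  refine (Finset.sum_le_sum fun p _ => measure_lt_trace_mul_sampleCov_sub_one_le (M p) hm
    (t := 4 * (d + t)) (by positivity) htm).trans ?_
  rw [Finset.sum_const, nsmul_eq_mul, ← ENNReal.ofReal_natCast,
    ← ENNReal.ofReal_mul (by positivity)]
  refine ENNReal.ofReal_le_ofReal ?_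
  have hcard : ((N ×ˢ N).card : ℝ) ≤ 25 ^ d := by
    rw [Finset.card_product]
    calc ((N.card * N.card : ℕ) : ℝ) ≤ ((5 ^ d * 5 ^ d : ℕ) : ℝ) := by
          exact_mod_cast Nat.mul_le_mul hNcard hNcard
      _ = 25 ^ d := by push_cast; rw [← mul_pow]; norm_num
  have hexp : (25 : ℝ) ^ d ≤ Real.exp (4 * d) := by
    rw [mul_comm, Real.exp_nat_mul]
    refine pow_le_pow_left₀ (by norm_num) ?_ d
    have h1 : (2.7 : ℝ) ≤ Real.exp 1 := by linarith [Real.exp_one_gt_d9]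
    calc (25 : ℝ) ≤ 2.7 ^ 4 := by norm_num
      _ ≤ Real.exp 1 ^ 4 := pow_le_pow_left₀ (by norm_num) h1 4
      _ = Real.exp 4 := by rw [← Real.exp_nat_mul]; norm_num
  calc ((N ×ˢ N).card : ℝ) * Real.exp (-(4 * (d + t)))
      ≤ Real.exp (4 * d) * Real.exp (-(4 * (d + t))) :=
        mul_le_mul_of_nonneg_right (hcard.trans hexp) (Real.exp_pos _).le
    _ = Real.exp (-(4 * t)) := by rw [← Real.exp_add]; ring_nf
    _ ≤ Real.exp (-t) := Real.exp_le_exp.2 (by linarith)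

/-! ### Matrices close to the identity -/

theorem norm_one_matrix_le : ‖(1 : Matrix (Fin d) (Fin d) ℝ)‖ ≤ 1 := by
  rw [Matrix.cstar_norm_def, map_one]
  exact ContinuousLinearMap.norm_id_le

theorem isUnit_of_norm_sub_one_le {W : Matrix (Fin d) (Fin d) ℝ} (hW : ‖W - 1‖ ≤ 1 / 2) :
    IsUnit W := by
  have h := (Units.oneSub (1 - W) (by rw [norm_sub_rev]; linarith)).isUnit
  simpa using h

theorem norm_inv_le {W : Matrix (Fin d) (Fin d) ℝ} (hW : ‖W - 1‖ ≤ 1 / 2) : ‖W⁻¹‖ ≤ 2 := by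
  have hu := (Matrix.isUnit_iff_isUnit_det _).1 (isUnit_of_norm_sub_one_le hW)
  have h1 : W⁻¹ = 1 - W⁻¹ * (W - 1) := by rw [mul_sub, Matrix.nonsing_inv_mul _ hu]; simp
  have h2 : ‖W⁻¹‖ ≤ 1 + ‖W⁻¹‖ * (1 / 2) := by
    conv_lhs => rw [h1]
    refine (norm_sub_le _ _).trans (add_le_add norm_one_matrix_le ((norm_mul_le _ _).trans ?_))
    exact mul_le_mul_of_nonneg_left hW (norm_nonneg _)
  linarith

theorem norm_inv_sub_one_le {W : Matrix (Fin d) (Fin d) ℝ} (hW : ‖W - 1‖ ≤ 1 / 2) :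
    ‖W⁻¹ - 1‖ ≤ 2 * ‖W - 1‖ := by
  have hu := (Matrix.isUnit_iff_isUnit_det _).1 (isUnit_of_norm_sub_one_le hW)
  have h1 : W⁻¹ - 1 = W⁻¹ * (1 - W) := by rw [mul_sub, Matrix.nonsing_inv_mul _ hu]; simp
  rw [h1, ← norm_sub_rev 1 W]
  exact (norm_mul_le _ _).trans (mul_le_mul_of_nonneg_right (norm_inv_le hW) (norm_nonneg _))

/-- By Cauchy–Schwarz against the identity, `Tr(W⁻¹ - 1)` is at most `√d · √d / 4` in absolute
value. This stands in for knowledge of the mean of the inverse sample covariance. -/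
theorem half_mul_card_le_trace_inv {W : Matrix (Fin d) (Fin d) ℝ} (hW : ‖W - 1‖ ≤ 1 / 8) :
    (d : ℝ) / 2 ≤ (W⁻¹).trace := by
  have h1 := abs_trace_mul_le (W⁻¹ - 1) 1
  have h2 := frobNorm_le_sqrt_mul_opNorm (W⁻¹ - 1)
  have h3 := frobNorm_le_sqrt_mul_opNorm (1 : Matrix (Fin d) (Fin d) ℝ)
  have h4 := norm_inv_sub_one_le (hW.trans (by norm_num))
  have h5 : frobNorm (W⁻¹ - 1) * frobNorm (1 : Matrix (Fin d) (Fin d) ℝ)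
      ≤ (√d * (1 / 4)) * (√d * 1) := by
    refine mul_le_mul (h2.trans ?_) (h3.trans ?_) (frobNorm_nonneg _) (by positivity)
    · exact mul_le_mul_of_nonneg_left (by linarith) (Real.sqrt_nonneg _)
    · exact mul_le_mul_of_nonneg_left norm_one_matrix_le (Real.sqrt_nonneg _)
  have h6 : (√d * (1 / 4)) * (√d * 1) = (d : ℝ) / 4 := by
    have := Real.mul_self_sqrt (Nat.cast_nonneg (α := ℝ) d)
    linear_combination (1 / 4) * this
  rw [mul_one, trace_sub, trace_one, Fintype.card_fin] at h1
  have h7 := neg_le_of_abs_le (h1.trans (h5.trans_eq h6))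
  have h8 : (0 : ℝ) ≤ d := Nat.cast_nonneg d
  linarith

/-! ### The inverse sample covariance along a rotation path -/

/-- The cross covariance `(1/m) ∑ k, x k (y k)ᵀ`. -/
noncomputable def crossCov (x y : Fin m → EuclideanSpace ℝ (Fin d)) :
    Matrix (Fin d) (Fin d) ℝ :=
  Matrix.of fun i j => (∑ k, x k i * y k j) / (m : ℝ)

theorem sampleCov_add (a b : ℝ) (x y : Fin m → EuclideanSpace ℝ (Fin d)) :
    sampleCov (a • x + b • y) = a ^ 2 • sampleCov x + b ^ 2 • sampleCov y
      + (a * b) • (crossCov x y + crossCov y x) := by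
  ext i j
  simp only [sampleCov, crossCov, Matrix.add_apply, Matrix.smul_apply, Matrix.of_apply,
    Pi.add_apply, Pi.smul_apply, PiLp.add_apply, PiLp.smul_apply, smul_eq_mul, ← add_div,
    mul_div_assoc', ← Finset.sum_add_distrib, Finset.mul_sum]
  congr 1
  exact Finset.sum_congr rfl fun k _ => by ring

theorem trace_mul_crossCov (N : Matrix (Fin d) (Fin d) ℝ)
    (x y : Fin m → EuclideanSpace ℝ (Fin d)) :
    (N * crossCov x y).trace = (∑ k, inner ℝ (mulSample N x k) (y k)) / m := by
  simp only [Matrix.trace, Matrix.diag, Matrix.mul_apply, crossCov, Matrix.of_apply,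
    PiLp.inner_apply, mulSample_apply, Finset.sum_div, Finset.mul_sum]
  rw [Finset.sum_comm' (t' := Finset.univ) (s' := fun _ => Finset.univ) (by simp)]
  conv_rhs => rw [Finset.sum_comm' (t' := Finset.univ) (s' := fun _ => Finset.univ) (by simp)]
  rw [Finset.sum_comm]
  refine Finset.sum_congr rfl fun i _ => ?_
  rw [Finset.sum_comm]
  refine Finset.sum_congr rfl fun k _ => ?_
  simp only [RCLike.inner_apply, conj_trivial, Finset.mul_sum, Finset.sum_div]
  exact Finset.sum_congr rfl fun j _ => by ring

theorem crossCov_transpose (x y : Fin m → EuclideanSpace ℝ (Fin d)) :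
    (crossCov x y)ᵀ = crossCov y x := by
  ext i j; simp [crossCov, mul_comm]

theorem crossCov_self (x : Fin m → EuclideanSpace ℝ (Fin d)) : crossCov x x = sampleCov x := rfl

/-- The sum is exactly `m · Tr(N W Nᵀ)` with `W = sampleCov x`. It is the variance of the linear
functional of a Gaussian velocity that appears in the derivative along the arc. -/
theorem sum_norm_sq_mulSample_le (hm : 0 < m) (N : Matrix (Fin d) (Fin d) ℝ)
    (x : Fin m → EuclideanSpace ℝ (Fin d)) :
    ∑ k, ‖mulSample N x k‖ ^ 2 ≤ m * (‖sampleCov x‖ * frobNorm N ^ 2) := by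
  have hm' : (m : ℝ) ≠ 0 := by positivity
  have h1 := trace_mul_crossCov 1 (mulSample N x) (mulSample N x)
  have h2 : mulSample 1 (mulSample N x) = mulSample N x := by
    funext k; simp [mulSample]
  rw [h2, one_mul, crossCov_self, sampleCov_mulSample] at h1
  simp only [real_inner_self_eq_norm_sq] at h1
  have h3 : ∑ k, ‖mulSample N x k‖ ^ 2 = m * (N * sampleCov x * Nᵀ).trace := by
    rw [h1]; field_simp
  rw [h3]
  refine mul_le_mul_of_nonneg_left ?_ (Nat.cast_nonneg m)
  refine (le_abs_self _).trans ((abs_trace_mul_le _ _).trans ?_)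
  rw [frobNorm_transpose]
  calc frobNorm (N * sampleCov x) * frobNorm N
      ≤ (frobNorm N * ‖sampleCov x‖) * frobNorm N :=
        mul_le_mul_of_nonneg_right (frobNorm_mul_le_mul_opNorm _ _) (frobNorm_nonneg _)
    _ = _ := by ring

/-- The point at angle `θ` of the circle arc from `p.1` to `p.2`. -/
noncomputable def arc (p : (Fin m → EuclideanSpace ℝ (Fin d)) × (Fin m → EuclideanSpace ℝ (Fin d)))
    (θ : ℝ) : Fin m → EuclideanSpace ℝ (Fin d) :=
  Real.cos θ • p.1 + Real.sin θ • p.2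

/-- The velocity of `arc p` at angle `θ`. -/
noncomputable def arcVelocity
    (p : (Fin m → EuclideanSpace ℝ (Fin d)) × (Fin m → EuclideanSpace ℝ (Fin d)))
    (θ : ℝ) : Fin m → EuclideanSpace ℝ (Fin d) :=
  -Real.sin θ • p.1 + Real.cos θ • p.2

theorem hasDerivAt_sampleCov_arc
    (p : (Fin m → EuclideanSpace ℝ (Fin d)) × (Fin m → EuclideanSpace ℝ (Fin d))) (θ : ℝ) :
    HasDerivAt (fun θ => sampleCov (arc p θ))
      (crossCov (arc p θ) (arcVelocity p θ) + crossCov (arcVelocity p θ) (arc p θ)) θ := by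
  have h0 : (fun θ => sampleCov (arc p θ)) = fun θ => Real.cos θ ^ 2 • sampleCov p.1
      + Real.sin θ ^ 2 • sampleCov p.2
      + (Real.cos θ * Real.sin θ) • (crossCov p.1 p.2 + crossCov p.2 p.1) :=
    funext fun θ => sampleCov_add _ _ _ _
  have h1 := ((((Real.hasDerivAt_cos θ).pow 2).smul_const (sampleCov p.1)).add
    (((Real.hasDerivAt_sin θ).pow 2).smul_const (sampleCov p.2))).add
    (((Real.hasDerivAt_cos θ).mul (Real.hasDerivAt_sin θ)).smul_const
      (crossCov p.1 p.2 + crossCov p.2 p.1))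
  rw [h0]
  refine HasDerivAt.congr_deriv h1 ?_
  ext i j
  simp only [sampleCov, crossCov, arc, arcVelocity, Matrix.add_apply, Matrix.smul_apply,
    Matrix.of_apply, Pi.add_apply, Pi.smul_apply, PiLp.add_apply, PiLp.smul_apply, smul_eq_mul,
    ← add_div, mul_div_assoc', ← Finset.sum_add_distrib, Finset.mul_sum]
  congr 1
  refine Finset.sum_congr rfl fun k _ => ?_
  push_cast
  ring

/-- The matrix `W⁻¹ M W⁻¹` governing the derivative of `W ↦ Tr (M W⁻¹)`. -/
noncomputable def sandwich (M : Matrix (Fin d) (Fin d) ℝ)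
    (x : Fin m → EuclideanSpace ℝ (Fin d)) : Matrix (Fin d) (Fin d) ℝ :=
  (sampleCov x)⁻¹ * M * (sampleCov x)⁻¹

/-- From `d(W⁻¹) = -W⁻¹ (dW) W⁻¹`: the two mutually transposed parts of `dW` contribute equally
because `sandwich` is symmetric, whence the factor two. The derivative is linear in the velocity. -/
theorem hasDerivAt_trace_inv_arc {M : Matrix (Fin d) (Fin d) ℝ} (hM : M.IsHermitian)
    (p : (Fin m → EuclideanSpace ℝ (Fin d)) × (Fin m → EuclideanSpace ℝ (Fin d))) (θ : ℝ)
    (hp : ‖sampleCov (arc p θ) - 1‖ ≤ 1 / 2) :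
    HasDerivAt (fun θ => (M * (sampleCov (arc p θ))⁻¹).trace)
      (-(2 / m) * ∑ k, inner ℝ (mulSample (sandwich M (arc p θ)) (arc p θ) k)
        (arcVelocity p θ k)) θ := by
  obtain ⟨u, hu⟩ := isUnit_of_norm_sub_one_le hp
  have h1 := hasDerivAt_sampleCov_arc p θ
  have h2 := hasFDerivAt_ringInverse (𝕜 := ℝ) u
  rw [hu] at h2
  have h3 : HasDerivAt (Ring.inverse ∘ fun θ => sampleCov (arc p θ))
      (-((u⁻¹ : (Matrix (Fin d) (Fin d) ℝ)ˣ) * (crossCov (arc p θ) (arcVelocity p θ)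
        + crossCov (arcVelocity p θ) (arc p θ)) * (u⁻¹ : (Matrix (Fin d) (Fin d) ℝ)ˣ))) θ :=
    h2.comp_hasDerivAt θ h1
  let T : Matrix (Fin d) (Fin d) ℝ →ₗ[ℝ] ℝ :=
    (Matrix.traceLinearMap (Fin d) ℝ ℝ).comp (LinearMap.mulLeft ℝ M)
  have h4 := (LinearMap.toContinuousLinearMap T).hasFDerivAt.comp_hasDerivAt θ h3
  have hfun : (fun θ => (M * (sampleCov (arc p θ))⁻¹).trace)
      = (LinearMap.toContinuousLinearMap T) ∘ (Ring.inverse ∘ fun θ => sampleCov (arc p θ)) := by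
    funext t
    simp [T, Matrix.nonsing_inv_eq_ringInverse]
  rw [hfun]
  refine HasDerivAt.congr_deriv h4 ?_
  have hinv : ((u⁻¹ : (Matrix (Fin d) (Fin d) ℝ)ˣ) : Matrix (Fin d) (Fin d) ℝ)
      = (sampleCov (arc p θ))⁻¹ := by
    rw [← hu, Matrix.coe_units_inv]
  set x := arc p θ
  set w := arcVelocity p θ
  have hMT : Mᵀ = M := by rw [← Matrix.conjTranspose_eq_transpose_of_trivial]; exact hM
  have hsT : (sandwich M x)ᵀ = sandwich M x := by
    rw [sandwich, transpose_mul, transpose_mul, Matrix.transpose_nonsing_inv,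
      sampleCov_transpose, hMT, mul_assoc]
  have h5 : (sandwich M x * crossCov w x).trace = (sandwich M x * crossCov x w).trace := by
    rw [← trace_transpose, transpose_mul, crossCov_transpose, hsT, trace_mul_comm]
  have h6 : (M * ((sampleCov x)⁻¹ * (crossCov x w + crossCov w x) * (sampleCov x)⁻¹)).trace
      = 2 * (sandwich M x * crossCov x w).trace := by
    rw [← mul_assoc, trace_mul_comm, ← mul_assoc, ← mul_assoc, ← sandwich, mul_add, trace_add, h5]
    ring
  simp only [hinv, LinearMap.coe_toContinuousLinearMap', T, LinearMap.comp_apply,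
    Matrix.traceLinearMap_apply, LinearMap.mulLeft_apply, mul_neg, trace_neg, h6,
    trace_mul_crossCov]
  ring

/-! ### Concentration of the inverse sample covariance -/

/-- Pairs of samples such that the sample covariance stays near the identity along the arc joining
them. -/
def goodPairs (d m : ℕ) :
    Set ((Fin m → EuclideanSpace ℝ (Fin d)) × (Fin m → EuclideanSpace ℝ (Fin d))) :=
  {p | ‖sampleCov p.1 - 1‖ ≤ 1 / 8 ∧ ‖sampleCov p.2 - 1‖ ≤ 1 / 8 ∧
    ‖sampleCov (arc p (Real.pi / 4)) - 1‖ ≤ 1 / 8}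

theorem continuous_arc (θ : ℝ) : Continuous fun p : (Fin m → EuclideanSpace ℝ (Fin d)) ×
    (Fin m → EuclideanSpace ℝ (Fin d)) => arc p θ := by
  unfold arc; fun_prop

theorem measurableSet_goodPairs : MeasurableSet (goodPairs d m) := by
  have h := continuous_sampleCov (d := d) (m := m)
  have h4 := continuous_arc (d := d) (m := m) (Real.pi / 4)
  refine IsClosed.measurableSet ?_
  refine (isClosed_le ((h.comp continuous_fst).sub continuous_const).norm continuous_const).inter
    ((isClosed_le ((h.comp continuous_snd).sub continuous_const).norm continuous_const).inter
    (isClosed_le ((h.comp h4).sub continuous_const).norm continuous_const))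

/-- The covariance is a quadratic form in `(cos θ, sin θ)`, hence determined by its values at the
angles `0`, `π/2` and `π/4`. So three norm conditions control the whole arc, with bound `1/8 + 1/2 ·
1/2`. -/
theorem norm_sampleCov_arc_sub_one_le
    {p : (Fin m → EuclideanSpace ℝ (Fin d)) × (Fin m → EuclideanSpace ℝ (Fin d))}
    (hp : p ∈ goodPairs d m) (θ : ℝ) : ‖sampleCov (arc p θ) - 1‖ ≤ 1 / 2 := by
  obtain ⟨h1, h2, h3⟩ := hp
  have hmix : sampleCov (arc p (Real.pi / 4)) = (1 / 2 : ℝ) • sampleCov p.1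
      + (1 / 2 : ℝ) • sampleCov p.2 + (1 / 2 : ℝ) • (crossCov p.1 p.2 + crossCov p.2 p.1) := by
    have h2 : (√2 / 2) ^ 2 = (1 / 2 : ℝ) := by rw [div_pow, Real.sq_sqrt (by norm_num)]; norm_num
    rw [arc, sampleCov_add, Real.cos_pi_div_four, Real.sin_pi_div_four, ← sq, h2]
  have hcs : Real.cos θ ^ 2 + Real.sin θ ^ 2 = 1 := Real.cos_sq_add_sin_sq θ
  have hdec : sampleCov (arc p θ) - 1 = Real.cos θ ^ 2 • (sampleCov p.1 - 1)
      + Real.sin θ ^ 2 • (sampleCov p.2 - 1)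
      + (Real.cos θ * Real.sin θ) • ((2 : ℝ) • (sampleCov (arc p (Real.pi / 4)) - 1)
        - (sampleCov p.1 - 1) - (sampleCov p.2 - 1)) := by
    rw [hmix, arc, sampleCov_add]
    have : (1 : Matrix (Fin d) (Fin d) ℝ)
        = (Real.cos θ ^ 2 + Real.sin θ ^ 2) • (1 : Matrix (Fin d) (Fin d) ℝ) := by
      rw [hcs, one_smul]
    nth_rewrite 1 [this]
    module
  have hb : ‖(2 : ℝ) • (sampleCov (arc p (Real.pi / 4)) - 1)
        - (sampleCov p.1 - 1) - (sampleCov p.2 - 1)‖ ≤ 1 / 2 := by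
    refine (norm_sub_le _ _).trans ?_
    have := norm_sub_le ((2 : ℝ) • (sampleCov (arc p (Real.pi / 4)) - 1)) (sampleCov p.1 - 1)
    rw [norm_smul, Real.norm_two] at this
    linarith
  have hprod : |Real.cos θ * Real.sin θ| ≤ 1 / 2 := by
    rw [abs_le]
    constructor <;> nlinarith [sq_nonneg (Real.cos θ - Real.sin θ),
      sq_nonneg (Real.cos θ + Real.sin θ)]
  rw [hdec]
  refine (norm_add_le _ _).trans ((add_le_add_left (norm_add_le _ _) _).trans ?_)
  rw [norm_smul, norm_smul, norm_smul, Real.norm_eq_abs, Real.norm_eq_abs, Real.norm_eq_abs,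
    abs_of_nonneg (sq_nonneg _), abs_of_nonneg (sq_nonneg _)]
  have e1 := mul_le_mul_of_nonneg_left h1 (sq_nonneg (Real.cos θ))
  have e2 := mul_le_mul_of_nonneg_left h2 (sq_nonneg (Real.sin θ))
  have e3 := mul_le_mul hprod hb (norm_nonneg _) (by norm_num)
  nlinarith

/-- Inversion is not continuous at singular matrices, but Cramer's formula writes each entry as a
polynomial times the inverse of the determinant. -/
theorem measurable_inv_sampleCov (i j : Fin d) :
    Measurable fun z : Fin m → EuclideanSpace ℝ (Fin d) => (sampleCov z)⁻¹ i j := by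
  have h := continuous_sampleCov (d := d) (m := m)
  have h1 : Continuous fun z : Fin m → EuclideanSpace ℝ (Fin d) => (sampleCov z).det := h.matrix_det
  have h2 : Continuous fun z : Fin m → EuclideanSpace ℝ (Fin d) => (sampleCov z).adjugate i j :=
    h.matrix_adjugate.matrix_elem i j
  simp only [Matrix.inv_def, Matrix.smul_apply, smul_eq_mul, Ring.inverse_eq_inv']
  exact h1.measurable.inv.mul h2.measurable

theorem measurable_trace_mul_inv_sampleCov (M : Matrix (Fin d) (Fin d) ℝ) :
    Measurable fun z : Fin m → EuclideanSpace ℝ (Fin d) => (M * (sampleCov z)⁻¹).trace := by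
  simp only [Matrix.trace, Matrix.diag, Matrix.mul_apply]
  exact Finset.measurable_sum _ fun i _ => Finset.measurable_sum _ fun j _ =>
    (measurable_inv_sampleCov j i).const_mul _

theorem measurable_sandwich (M : Matrix (Fin d) (Fin d) ℝ) (i j : Fin d) :
    Measurable fun z : Fin m → EuclideanSpace ℝ (Fin d) => sandwich M z i j := by
  simp only [sandwich, Matrix.mul_apply]
  exact Finset.measurable_sum _ fun k _ => (Finset.measurable_sum _ fun l _ =>
    (measurable_inv_sampleCov i l).mul_const _).mul (measurable_inv_sampleCov k j)

theorem sum_norm_sq_sandwich_le (hm : 0 < m) (M : Matrix (Fin d) (Fin d) ℝ)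
    {x : Fin m → EuclideanSpace ℝ (Fin d)} (hx : ‖sampleCov x - 1‖ ≤ 1 / 2) :
    ∑ k, ‖mulSample (sandwich M x) x k‖ ^ 2 ≤ m * (24 * frobNorm M ^ 2) := by
  refine (sum_norm_sq_mulSample_le hm _ x).trans (mul_le_mul_of_nonneg_left ?_ (Nat.cast_nonneg m))
  have hinv := norm_inv_le hx
  have h1 : ‖sampleCov x‖ ≤ 3 / 2 := by
    have := norm_add_le (sampleCov x - 1) 1
    rw [sub_add_cancel] at this
    linarith [norm_one_matrix_le (d := d)]
  have h2 : frobNorm (sandwich M x) ≤ 4 * frobNorm M := by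
    calc frobNorm (sandwich M x) ≤ frobNorm ((sampleCov x)⁻¹ * M) * ‖(sampleCov x)⁻¹‖ :=
          frobNorm_mul_le_mul_opNorm _ _
      _ ≤ (‖(sampleCov x)⁻¹‖ * frobNorm M) * ‖(sampleCov x)⁻¹‖ :=
          mul_le_mul_of_nonneg_right (frobNorm_mul_le_opNorm_mul _ _) (norm_nonneg _)
      _ ≤ (2 * frobNorm M) * 2 := by
          have := frobNorm_nonneg M
          gcongr
      _ = 4 * frobNorm M := by ring
  calc ‖sampleCov x‖ * frobNorm (sandwich M x) ^ 2 ≤ 3 / 2 * (4 * frobNorm M) ^ 2 :=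
        mul_le_mul h1 (pow_le_pow_left₀ (frobNorm_nonneg _) h2 2) (sq_nonneg _) (by norm_num)
    _ = 24 * frobNorm M ^ 2 := by ring

/-- Jensen's inequality along the arc. -/
theorem exp_sub_le_lintegral_arc {M : Matrix (Fin d) (Fin d) ℝ} (hM : M.IsHermitian) (s : ℝ)
    {p : (Fin m → EuclideanSpace ℝ (Fin d)) × (Fin m → EuclideanSpace ℝ (Fin d))}
    (hp : p ∈ goodPairs d m) :
    ENNReal.ofReal (Real.exp (s * ((M * (sampleCov p.2)⁻¹).trace - (M * (sampleCov p.1)⁻¹).trace)))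
      ≤ ENNReal.ofReal (2 / Real.pi) * ∫⁻ θ in Set.Ioc 0 (Real.pi / 2),
        ENNReal.ofReal (Real.exp (∑ k, inner ℝ
          ((-(s * Real.pi / m)) • mulSample (sandwich M (arc p θ)) (arc p θ) k)
          (arcVelocity p θ k))) := by
  have hgood := norm_sampleCov_arc_sub_one_le hp
  set φ' : ℝ → ℝ := fun θ => -(2 / m) * ∑ k, inner ℝ
    (mulSample (sandwich M (arc p θ)) (arc p θ) k) (arcVelocity p θ k) with hφ'
  have hderiv : ∀ θ, HasDerivAt (fun θ => (M * (sampleCov (arc p θ))⁻¹).trace) (φ' θ) θ :=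
    fun θ => hasDerivAt_trace_inv_arc hM p θ (hgood θ)
  have harc : Continuous fun θ => arc p θ := by unfold arc; fun_prop
  have hvel : Continuous fun θ => arcVelocity p θ := by unfold arcVelocity; fun_prop
  have hcov : Continuous fun θ => sampleCov (arc p θ) := continuous_sampleCov.comp harc
  have hinv : Continuous fun θ => (sampleCov (arc p θ))⁻¹ := by
    rw [continuous_iff_continuousAt]
    intro θ
    obtain ⟨u, hu⟩ := isUnit_of_norm_sub_one_le (hgood θ)
    simp_rw [Matrix.nonsing_inv_eq_ringInverse]
    have h1 := NormedRing.inverse_continuousAt u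
    rw [hu] at h1
    exact ContinuousAt.comp (g := Ring.inverse) h1 hcov.continuousAt
  have hsand : Continuous fun θ => sandwich M (arc p θ) := by
    unfold sandwich
    exact (hinv.mul continuous_const).mul hinv
  have hcont : Continuous φ' := by
    have h1 : φ' = fun θ => -(2 / m) * ∑ k, ∑ i,
        (∑ j, sandwich M (arc p θ) i j * arc p θ k j) * arcVelocity p θ k i := by
      funext θ
      simp only [hφ', PiLp.inner_apply, mulSample_apply, RCLike.inner_apply, conj_trivial]
      simp only [mul_comm]
    rw [h1]
    refine continuous_const.mul (continuous_finsetSum _ fun k _ => continuous_finsetSum _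
      fun i _ => (continuous_finsetSum _ fun j _ => (hsand.matrix_elem i j).mul ?_).mul ?_)
    · exact (EuclideanSpace.proj (𝕜 := ℝ) j).continuous.comp ((continuous_apply k).comp harc)
    · exact (EuclideanSpace.proj (𝕜 := ℝ) i).continuous.comp ((continuous_apply k).comp hvel)
  have hpi : (0 : ℝ) < Real.pi / 2 := by positivity
  have hftc := intervalIntegral.integral_eq_sub_of_hasDerivAt (a := 0) (b := Real.pi / 2)
    (fun θ _ => hderiv θ) (hcont.intervalIntegrable _ _)
  have h0 : arc p 0 = p.1 := by simp [arc]
  have h1 : arc p (Real.pi / 2) = p.2 := by simp [arc]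
  rw [h0, h1, intervalIntegral.integral_of_le hpi.le] at hftc
  set I : Set ℝ := Set.Ioc 0 (Real.pi / 2) with hI
  have hvol : volume.real I = Real.pi / 2 := by
    rw [hI, Real.volume_real_Ioc_of_le hpi.le, sub_zero]
  have hvol0 : volume I ≠ 0 := by
    rw [hI, Real.volume_Ioc]; simp [hpi]
  have hvolT : volume I ≠ ⊤ := by rw [hI, Real.volume_Ioc]; exact ENNReal.ofReal_ne_top
  -- The factor `π / 2`, the length of the interval, makes the mean of `h` equal to `s` times the
  -- total increment.
  set h : ℝ → ℝ := fun θ => s * (Real.pi / 2) * φ' θ with hh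
  have hhcont : Continuous h := continuous_const.mul hcont
  have hint : ∀ {f : ℝ → ℝ}, Continuous f → IntegrableOn f I := fun hf =>
    (hf.integrableOn_Icc).mono_set Set.Ioc_subset_Icc_self
  have hjensen := convexOn_exp.map_set_average_le (μ := volume) (t := I) (f := h)
    Real.continuous_exp.continuousOn isClosed_univ hvol0 hvolT (by simp) (hint hhcont)
    (hint (Real.continuous_exp.comp hhcont))
  rw [setAverage_eq, setAverage_eq, hvol] at hjensen
  have hleft : (Real.pi / 2)⁻¹ • ∫ θ in I, h θ
      = s * ((M * (sampleCov p.2)⁻¹).trace - (M * (sampleCov p.1)⁻¹).trace) := by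
    rw [← hftc, hh, integral_const_mul, smul_eq_mul]
    have := Real.pi_pos.ne'
    field_simp
  have hpt : ∀ θ, h θ = ∑ k, inner ℝ
      ((-(s * Real.pi / m)) • mulSample (sandwich M (arc p θ)) (arc p θ) k)
      (arcVelocity p θ k) := by
    intro θ
    simp only [hh, hφ', real_inner_smul_left, ← Finset.mul_sum]
    ring
  rw [hleft] at hjensen
  refine (ENNReal.ofReal_le_ofReal hjensen).trans (le_of_eq ?_)
  rw [smul_eq_mul, ENNReal.ofReal_mul (by positivity), inv_div,
    ofReal_integral_eq_lintegral_ofReal (f := fun θ => Real.exp (h θ))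
      (hint (Real.continuous_exp.comp hhcont))
      (Filter.Eventually.of_forall fun _ => (Real.exp_pos _).le)]
  simp only [hpt]

/-- Exponential moment bound of Maurey–Pisier type for the inverse sample covariance. -/
theorem lintegral_goodPairs_exp_le {M : Matrix (Fin d) (Fin d) ℝ} (hM : M.IsHermitian)
    (hm : 0 < m) (s : ℝ) :
    ∫⁻ p in goodPairs d m, ENNReal.ofReal (Real.exp
        (s * ((M * (sampleCov p.2)⁻¹).trace - (M * (sampleCov p.1)⁻¹).trace)))
        ∂((gaussianSample d m).prod (gaussianSample d m))
      ≤ ENNReal.ofReal (Real.exp (120 * s ^ 2 * frobNorm M ^ 2 / m)) := by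
  set μ := gaussianSample d m
  set U : Set (Fin m → EuclideanSpace ℝ (Fin d)) := {z | ‖sampleCov z - 1‖ ≤ 1 / 2} with hU
  have hUm : MeasurableSet U :=
    (isClosed_le (continuous_sampleCov.sub continuous_const).norm continuous_const).measurableSet
  -- `goodPairs` is not rotation invariant. On it the whole arc stays in `U`, so the indicator of
  -- `U` in the position alone may replace it and still leaves the velocity free to be integrated.
  set F : (Fin m → EuclideanSpace ℝ (Fin d)) × (Fin m → EuclideanSpace ℝ (Fin d)) → ENNReal :=
    fun q => U.indicator 1 q.1 * ENNReal.ofReal (Real.exp (∑ k, inner ℝ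
      ((-(s * Real.pi / m)) • mulSample (sandwich M q.1) q.1 k) (q.2 k))) with hF
  have hFm : Measurable F := by
    have h1 : Measurable fun q : (Fin m → EuclideanSpace ℝ (Fin d)) ×
        (Fin m → EuclideanSpace ℝ (Fin d)) => ∑ k, ∑ i,
          ((-(s * Real.pi / m)) * ∑ j, sandwich M q.1 i j * q.1 k j) * q.2 k i := by
      refine Finset.measurable_sum _ fun k _ => Finset.measurable_sum _ fun i _ =>
        ((Finset.measurable_sum _ fun j _ =>
          ((measurable_sandwich M i j).comp measurable_fst).mul ?_).const_mul _).mul ?_ <;> fun_prop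
    have h2 : ∀ q : (Fin m → EuclideanSpace ℝ (Fin d)) × (Fin m → EuclideanSpace ℝ (Fin d)),
        (∑ k, inner ℝ ((-(s * Real.pi / m)) • mulSample (sandwich M q.1) q.1 k) (q.2 k))
        = ∑ k, ∑ i, ((-(s * Real.pi / m)) * ∑ j, sandwich M q.1 i j * q.1 k j) * q.2 k i := by
      intro q
      simp only [PiLp.inner_apply, PiLp.smul_apply, mulSample_apply, RCLike.inner_apply,
        conj_trivial, smul_eq_mul]
      exact Finset.sum_congr rfl fun k _ => Finset.sum_congr rfl fun i _ => mul_comm _ _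
    simp only [hF, h2]
    exact ((measurable_one.indicator hUm).comp measurable_fst).mul h1.exp.ennreal_ofReal
  have hpoint : ∀ p ∈ goodPairs d m, ENNReal.ofReal (Real.exp
        (s * ((M * (sampleCov p.2)⁻¹).trace - (M * (sampleCov p.1)⁻¹).trace)))
      ≤ ENNReal.ofReal (2 / Real.pi) * ∫⁻ θ in Set.Ioc 0 (Real.pi / 2),
        F (arc p θ, arcVelocity p θ) := by
    intro p hp
    refine (exp_sub_le_lintegral_arc hM s hp).trans (le_of_eq ?_)
    congr 1
    refine lintegral_congr fun θ => ?_
    have : arc p θ ∈ U := norm_sampleCov_arc_sub_one_le hp θ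
    simp [hF, this]
  have hjoint : Measurable fun q : ((Fin m → EuclideanSpace ℝ (Fin d)) ×
      (Fin m → EuclideanSpace ℝ (Fin d))) × ℝ => F (arc q.1 q.2, arcVelocity q.1 q.2) := by
    refine hFm.comp (Continuous.measurable ?_)
    unfold arc arcVelocity
    fun_prop
  -- After undoing the rotation the velocity is Gaussian and independent of the position. Its
  -- integral has exponent at most `(sπ/m)² · 24 m ‖M‖_F² / 2 = 12 π² s² ‖M‖_F² / m`, and `π² ≤ 10`
  -- gives the constant `120`.
  have hfix : ∀ θ, ∫⁻ p, F (arc p θ, arcVelocity p θ) ∂(μ.prod μ)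
      ≤ ENNReal.ofReal (Real.exp (120 * s ^ 2 * frobNorm M ^ 2 / m)) := by
    intro θ
    have h1 : ∫⁻ p, F (arc p θ, arcVelocity p θ) ∂(μ.prod μ) = ∫⁻ p, F p ∂(μ.prod μ) :=
      (measurePreserving_rotation θ).lintegral_comp hFm
    rw [h1, lintegral_prod _ hFm.aemeasurable]
    have h2 : ∀ z, ∫⁻ w, F (z, w) ∂μ
        ≤ ENNReal.ofReal (Real.exp (120 * s ^ 2 * frobNorm M ^ 2 / m)) := by
      intro z
      by_cases hz : z ∈ U
      · simp only [hF, Set.indicator_of_mem hz, Pi.one_apply, one_mul]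
        rw [lintegral_exp_sum_inner]
        refine ENNReal.ofReal_le_ofReal (Real.exp_le_exp.2 ?_)
        have hm' : (0 : ℝ) < m := by positivity
        simp only [norm_smul, mul_pow, ← Finset.mul_sum, Real.norm_eq_abs, sq_abs]
        have h3 := sum_norm_sq_sandwich_le hm M hz
        have hpi : Real.pi ^ 2 ≤ 10 := by nlinarith [Real.pi_gt_three, Real.pi_lt_d2]
        have h4 := mul_le_mul_of_nonneg_left h3 (sq_nonneg (-(s * Real.pi / m)))
        have h5 : (-(s * Real.pi / m)) ^ 2 * (m * (24 * frobNorm M ^ 2)) / 2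
            = 12 * (s ^ 2 * frobNorm M ^ 2 / m) * Real.pi ^ 2 := by field_simp; ring
        have h6 : 12 * (s ^ 2 * frobNorm M ^ 2 / m) * Real.pi ^ 2
            ≤ 12 * (s ^ 2 * frobNorm M ^ 2 / m) * 10 :=
          mul_le_mul_of_nonneg_left hpi (by positivity)
        have h7 : 12 * (s ^ 2 * frobNorm M ^ 2 / m) * 10 = 120 * s ^ 2 * frobNorm M ^ 2 / m := by
          ring
        linarith
      · simp [hF, hz]
    exact (lintegral_mono h2).trans (by simp)
  calc ∫⁻ p in goodPairs d m, ENNReal.ofReal (Real.exp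
        (s * ((M * (sampleCov p.2)⁻¹).trace - (M * (sampleCov p.1)⁻¹).trace))) ∂(μ.prod μ)
      ≤ ∫⁻ p in goodPairs d m, (ENNReal.ofReal (2 / Real.pi) *
          ∫⁻ θ in Set.Ioc 0 (Real.pi / 2), F (arc p θ, arcVelocity p θ)) ∂(μ.prod μ) :=
        setLIntegral_mono' measurableSet_goodPairs hpoint
    _ ≤ ∫⁻ p, (ENNReal.ofReal (2 / Real.pi) *
          ∫⁻ θ in Set.Ioc 0 (Real.pi / 2), F (arc p θ, arcVelocity p θ)) ∂(μ.prod μ) :=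
        setLIntegral_le_lintegral _ _
    _ = ENNReal.ofReal (2 / Real.pi) * ∫⁻ θ in Set.Ioc 0 (Real.pi / 2),
          ∫⁻ p, F (arc p θ, arcVelocity p θ) ∂(μ.prod μ) := by
        rw [lintegral_const_mul _ hjoint.lintegral_prod_right',
          lintegral_lintegral_swap hjoint.aemeasurable]
    _ ≤ ENNReal.ofReal (2 / Real.pi) * ∫⁻ _ in Set.Ioc 0 (Real.pi / 2),
          ENNReal.ofReal (Real.exp (120 * s ^ 2 * frobNorm M ^ 2 / m)) := by
        gcongr with θ
        exact hfix θ
    _ = ENNReal.ofReal (Real.exp (120 * s ^ 2 * frobNorm M ^ 2 / m)) := by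
        rw [setLIntegral_const, Real.volume_Ioc, mul_comm (ENNReal.ofReal (Real.exp _)),
          ← mul_assoc, ← ENNReal.ofReal_mul (by positivity), sub_zero]
        have : 2 / Real.pi * (Real.pi / 2) = 1 := by
          have := Real.pi_pos.ne'
          field_simp
        rw [this, ENNReal.ofReal_one, one_mul]

theorem measure_norm_sampleCov_sub_one_gt_le {t : ℝ} (ht : 0 ≤ t) (hm : 0 < m)
    (htm : 102400 * (d + t) ≤ m) :
    gaussianSample d m {z | ¬ ‖sampleCov z - 1‖ ≤ 1 / 8} ≤ ENNReal.ofReal (Real.exp (-t)) := by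
  have hm' : (0 : ℝ) < m := by positivity
  refine (measure_mono fun z hz => ?_).trans
    (measure_lt_norm_sampleCov_sub_one_le (d := d) ht hm ?_)
  -- Here `102400 = 320²`, and `40 / 320 = 1 / 8`.
  · have h1 : √((d + t) / m) ≤ 1 / 320 := by
      rw [Real.sqrt_le_left (by norm_num), div_le_iff₀ hm']
      linarith
    have h2 : 1 / 8 < ‖sampleCov z - 1‖ := not_le.1 hz
    change 40 * √((d + t) / m) < ‖sampleCov z - 1‖
    linarith
  · have : (0 : ℝ) ≤ d := Nat.cast_nonneg d
    linarith

theorem measurePreserving_arc (θ : ℝ) :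
    MeasurePreserving (fun p : (Fin m → EuclideanSpace ℝ (Fin d)) ×
      (Fin m → EuclideanSpace ℝ (Fin d)) => arc p θ)
      ((gaussianSample d m).prod (gaussianSample d m)) (gaussianSample d m) :=
  measurePreserving_fst.comp (measurePreserving_rotation θ)

/-- All three samples tested in `goodPairs` have the standard Gaussian law, so each condition fails
with probability at most `exp (-t)`. -/
theorem measure_compl_goodPairs_le {t : ℝ} (ht : 0 ≤ t) (hm : 0 < m)
    (htm : 102400 * (d + t) ≤ m) :
    ((gaussianSample d m).prod (gaussianSample d m)) (goodPairs d m)ᶜ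
      ≤ 3 * ENNReal.ofReal (Real.exp (-t)) := by
  set μ := gaussianSample d m
  set B : Set (Fin m → EuclideanSpace ℝ (Fin d)) := {z | ¬ ‖sampleCov z - 1‖ ≤ 1 / 8} with hB
  have hBm : MeasurableSet B :=
    (isClosed_le (continuous_sampleCov.sub continuous_const).norm
      continuous_const).measurableSet.compl
  have hμB : μ B ≤ ENNReal.ofReal (Real.exp (-t)) :=
    measure_norm_sampleCov_sub_one_gt_le ht hm htm
  have hpre : ∀ {f : (Fin m → EuclideanSpace ℝ (Fin d)) × (Fin m → EuclideanSpace ℝ (Fin d)) →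
      (Fin m → EuclideanSpace ℝ (Fin d))}, MeasurePreserving f (μ.prod μ) μ →
      (μ.prod μ) (f ⁻¹' B) ≤ ENNReal.ofReal (Real.exp (-t)) := fun hf => by
    rw [hf.measure_preimage hBm.nullMeasurableSet]; exact hμB
  have hsub : (goodPairs d m)ᶜ ⊆ (Prod.fst ⁻¹' B ∪ Prod.snd ⁻¹' B)
      ∪ (fun p => arc p (Real.pi / 4)) ⁻¹' B := by
    intro p hp
    by_contra hcon
    simp only [Set.mem_union, not_or] at hcon
    exact hp ⟨not_not.1 hcon.1.1, not_not.1 hcon.1.2, not_not.1 hcon.2⟩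
  calc (μ.prod μ) (goodPairs d m)ᶜ ≤ _ := measure_mono hsub
    _ ≤ (μ.prod μ) (Prod.fst ⁻¹' B ∪ Prod.snd ⁻¹' B)
        + (μ.prod μ) ((fun p => arc p (Real.pi / 4)) ⁻¹' B) := measure_union_le _ _
    _ ≤ (ENNReal.ofReal (Real.exp (-t)) + ENNReal.ofReal (Real.exp (-t)))
        + ENNReal.ofReal (Real.exp (-t)) :=
        add_le_add ((measure_union_le _ _).trans
          (add_le_add (hpre measurePreserving_fst) (hpre measurePreserving_snd)))
          (hpre (measurePreserving_arc _))
    _ = 3 * ENNReal.ofReal (Real.exp (-t)) := by ring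

/-- Averaging a symmetric matrix over the cyclic shifts of its eigenbasis gives a multiple of the
identity. -/
theorem exists_orthogonal_family_sum [NeZero d] {M : Matrix (Fin d) (Fin d) ℝ}
    (hM : M.IsHermitian) : ∃ O : Fin d → Matrix (Fin d) (Fin d) ℝ,
      (∀ j, O j * (O j)ᵀ = 1) ∧ ∑ j, (O j)ᵀ * M * O j = M.trace • 1 := by
  obtain ⟨U, hU, hU', hMU⟩ := exists_orthogonal_diagonal hM
  set v := hM.eigenvalues
  -- Permutation matrices of the cyclic shifts: conjugation by them shifts the eigenvalues, and
  -- every diagonal position meets each eigenvalue exactly once.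
  let P : Fin d → Matrix (Fin d) (Fin d) ℝ := fun j =>
    (1 : Matrix (Fin d) (Fin d) ℝ).submatrix (Equiv.refl _) (Equiv.addRight j)
  have hPT : ∀ j, (P j)ᵀ
      = (1 : Matrix (Fin d) (Fin d) ℝ).submatrix (Equiv.addRight j) (Equiv.refl _) := fun j => by
    simp [P]
  have hPP : ∀ j, P j * (P j)ᵀ = 1 := fun j => by
    rw [hPT, Matrix.submatrix_mul_equiv, mul_one]; simp
  have hPD : ∀ j, (P j)ᵀ * diagonal v * P j = diagonal fun i => v (i + j) := fun j => by
    have h1 : diagonal v = (diagonal v).submatrix (Equiv.refl (Fin d)) (Equiv.refl (Fin d)) := by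
      simp
    rw [hPT, h1, Matrix.submatrix_mul_equiv, Matrix.submatrix_mul_equiv, one_mul, mul_one,
      Matrix.submatrix_diagonal_equiv]
    rfl
  have hsum : ∑ j, (P j)ᵀ * diagonal v * P j = (∑ i, v i) • 1 := by
    ext a b
    simp only [hPD, Matrix.sum_apply, Matrix.smul_apply, Matrix.one_apply, Matrix.diagonal_apply,
      smul_eq_mul, mul_ite, mul_one, mul_zero]
    split_ifs
    · exact Equiv.sum_comp (Equiv.addLeft a) v
    · simp
  have htr : M.trace = ∑ i, v i := by
    conv_lhs => rw [hMU]
    rw [trace_conj_orthogonal hU]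
    simp [Matrix.trace]
  refine ⟨fun j => U * P j * Uᵀ, fun j => ?_, ?_⟩
  · simp only [transpose_mul, transpose_transpose]
    calc U * P j * Uᵀ * (U * ((P j)ᵀ * Uᵀ)) = U * P j * (Uᵀ * U) * (P j)ᵀ * Uᵀ := by
          simp only [mul_assoc]
      _ = U * (P j * (P j)ᵀ) * Uᵀ := by rw [hU, mul_one]; simp only [mul_assoc]
      _ = 1 := by rw [hPP, mul_one, hU']
  · have h1 : ∀ j, (U * P j * Uᵀ)ᵀ * M * (U * P j * Uᵀ)
        = U * ((P j)ᵀ * diagonal v * P j) * Uᵀ := fun j => by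
      simp only [transpose_mul, transpose_transpose]
      calc U * ((P j)ᵀ * Uᵀ) * M * (U * P j * Uᵀ)
          = U * (P j)ᵀ * (Uᵀ * M * U) * P j * Uᵀ := by simp only [mul_assoc]
        _ = U * (P j)ᵀ * ((Uᵀ * U) * diagonal v * (Uᵀ * U)) * P j * Uᵀ := by
            conv_lhs => rw [hMU]
            simp only [mul_assoc]
        _ = _ := by rw [hU, one_mul, mul_one]; simp only [mul_assoc]
    simp only [h1]
    rw [← Finset.sum_mul, ← Finset.mul_sum, hsum, htr, mul_smul_comm, mul_one,
      smul_mul_assoc, hU']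

theorem trace_mul_inv_sampleCov_mulSample (M : Matrix (Fin d) (Fin d) ℝ)
    {O : Matrix (Fin d) (Fin d) ℝ} (hO : O * Oᵀ = 1) (z : Fin m → EuclideanSpace ℝ (Fin d)) :
    (M * (sampleCov (mulSample O z))⁻¹).trace = (Oᵀ * M * O * (sampleCov z)⁻¹).trace := by
  have h1 : O⁻¹ = Oᵀ := Matrix.inv_eq_right_inv hO
  have h2 : (Oᵀ)⁻¹ = O := Matrix.inv_eq_left_inv hO
  rw [sampleCov_mulSample, Matrix.mul_inv_rev, Matrix.mul_inv_rev, h1, h2, ← mul_assoc,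
    ← mul_assoc, trace_mul_comm]
  simp only [mul_assoc]

/-- Lower deviations of the inverse sample covariance in a fixed direction. -/
theorem measure_trace_mul_inv_sampleCov_lt_le [NeZero d] {M : Matrix (Fin d) (Fin d) ℝ}
    (hM : M.IsHermitian) (htr : 0 ≤ M.trace) {t : ℝ} (ht : 0 ≤ t) (hm : 0 < m)
    (htm : 102400 * (d + t) ≤ m) :
    gaussianSample d m {z | (M * (sampleCov z)⁻¹).trace
        < M.trace / 2 - 24 * frobNorm M * √(t / m)}
      ≤ ENNReal.ofReal (4 * d * Real.exp (-t)) := by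
  have hm' : (0 : ℝ) < m := by positivity
  have hd : (0 : ℝ) < d := Nat.cast_pos.2 (NeZero.pos d)
  set μ := gaussianSample d m
  set a := frobNorm M
  set r := √(t / m) with hr
  have hr2 : m * r ^ 2 = t := by
    rw [hr, Real.sq_sqrt (by positivity)]; field_simp
  have hr0 : 0 ≤ r := Real.sqrt_nonneg _
  obtain ⟨O, hO, hsum⟩ := exists_orthogonal_family_sum hM
  set f : (Fin m → EuclideanSpace ℝ (Fin d)) → ℝ := fun z => (M * (sampleCov z)⁻¹).trace with hf
  have hfm : Measurable f := measurable_trace_mul_inv_sampleCov M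
  set bad : Set ((Fin m → EuclideanSpace ℝ (Fin d)) × (Fin m → EuclideanSpace ℝ (Fin d))) :=
    (goodPairs d m)ᶜ ∪ ({p | 24 * a * r < f p.2 - f p.1} ∩ goodPairs d m) with hbad
  have hdev : MeasurableSet {p : (Fin m → EuclideanSpace ℝ (Fin d)) ×
      (Fin m → EuclideanSpace ℝ (Fin d)) | 24 * a * r < f p.2 - f p.1} :=
    measurableSet_lt measurable_const
      ((hfm.comp measurable_snd).sub (hfm.comp measurable_fst))
  have hbadm : MeasurableSet bad :=
    measurableSet_goodPairs.compl.union (hdev.inter measurableSet_goodPairs)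
  have hdevle : (μ.prod μ) ({p | 24 * a * r < f p.2 - f p.1} ∩ goodPairs d m)
      ≤ ENNReal.ofReal (Real.exp (-t)) := by
    rcases (frobNorm_nonneg M).eq_or_lt with h0 | h0
    · have hf0 : ∀ z, f z = 0 := fun z => by
        have := abs_trace_mul_le M (sampleCov z)⁻¹
        rw [← h0, zero_mul] at this
        exact abs_nonpos_iff.1 this
      have : {p : (Fin m → EuclideanSpace ℝ (Fin d)) × (Fin m → EuclideanSpace ℝ (Fin d)) |
          24 * a * r < f p.2 - f p.1} = ∅ := by
        ext p
        simp [hf0, a, ← h0]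
      rw [this]; simp
    have ha : 0 < a := h0
    -- The exponent becomes `120/144 · t` against the threshold `2t`.
    set s := m * r / (12 * a) with hs
    have hsa : s * a = m * r / 12 := by rw [hs]; field_simp
    have hs0 : 0 ≤ s := by positivity
    have hexp := measure_le_of_lintegral_exp_le
      (f := fun p : (Fin m → EuclideanSpace ℝ (Fin d)) × (Fin m → EuclideanSpace ℝ (Fin d)) =>
        s * (f p.2 - f p.1))
      (((hfm.comp measurable_snd).sub (hfm.comp measurable_fst)).const_mul s)
      (a := s * (24 * a * r)) (lintegral_goodPairs_exp_le hM hm s)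
    rw [← Measure.restrict_apply hdev]
    refine (measure_mono fun p hp => ?_).trans
      (hexp.trans (ENNReal.ofReal_le_ofReal (Real.exp_le_exp.2 ?_)))
    · exact mul_le_mul_of_nonneg_left (le_of_lt hp) hs0
    · have h1 : s * (24 * a * r) = 2 * t := by
        rw [← hr2]; linear_combination 24 * r * hsa
      have h2 : 120 * s ^ 2 * frobNorm M ^ 2 / m = 120 / 144 * t := by
        have h3 : s ^ 2 * frobNorm M ^ 2 = (m * r / 12) ^ 2 := by rw [← hsa, mul_pow]
        rw [mul_assoc, h3, ← hr2]
        field_simp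
        norm_num
      rw [h1, h2]
      linarith
  have hbadle : (μ.prod μ) bad ≤ ENNReal.ofReal (4 * Real.exp (-t)) := by
    refine (measure_union_le _ _).trans
      ((add_le_add (measure_compl_goodPairs_le ht hm htm) hdevle).trans (le_of_eq ?_))
    rw [ENNReal.ofReal_mul (by norm_num), ENNReal.ofReal_ofNat]
    ring
  -- If no rotated pair is bad, then `f (O j z') ≤ f z + 24 a r` for every `j`. The average of the
  -- left sides over `j` is `Tr M · Tr(W⁻¹) / d` with `W = sampleCov z'`, hence at least `Tr M / 2`,
  -- so `f z` cannot be that small. The union over `j` accounts for the factor `d` in the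
  -- probability.
  have hcover : {z | f z < M.trace / 2 - 24 * a * r} ×ˢ Set.univ
      ⊆ ⋃ j, (Prod.map id (mulSample (O j))) ⁻¹' bad := by
    rintro ⟨z, z'⟩ ⟨hz, -⟩
    by_contra hcon
    simp only [Set.mem_iUnion, Set.mem_preimage, Prod.map_apply, id, not_exists, hbad,
      Set.mem_union, not_or, Set.mem_compl_iff, not_not, Set.mem_inter_iff, not_and'] at hcon
    have hgood : ∀ j, (z, mulSample (O j) z') ∈ goodPairs d m := fun j => (hcon j).1
    have hle : ∀ j, f (mulSample (O j) z') ≤ f z + 24 * a * r := fun j => by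
      have h1 : ¬ 24 * a * r < f (mulSample (O j) z') - f z := (hcon j).2 (hgood j)
      have := not_lt.1 h1
      linarith
    have hz' : f z < M.trace / 2 - 24 * a * r := hz
    have havg : ∑ j, f (mulSample (O j) z') = M.trace * ((sampleCov z')⁻¹).trace := by
      simp only [hf, trace_mul_inv_sampleCov_mulSample M (hO _)]
      rw [← trace_sum, ← Finset.sum_mul, hsum, smul_mul_assoc, one_mul, trace_smul, smul_eq_mul]
    -- Goodness is known for the rotated sample rather than for `z'`; the trace of the inverse
    -- covariance is the same for both.
    have hhalf : (d : ℝ) / 2 ≤ ((sampleCov z')⁻¹).trace := by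
      have h1 := half_mul_card_le_trace_inv (hgood 0).2.1
      have h2 := trace_mul_inv_sampleCov_mulSample 1 (hO 0) z'
      rw [one_mul, mul_one, mul_eq_one_comm.1 (hO 0), one_mul] at h2
      rwa [← h2]
    have h1 : ∑ j, f (mulSample (O j) z') ≤ d * (f z + 24 * a * r) := by
      refine (Finset.sum_le_sum fun j _ => hle j).trans (le_of_eq ?_)
      simp only [Finset.sum_const, Finset.card_univ, Fintype.card_fin, nsmul_eq_mul]
    have h2 : (d : ℝ) * (M.trace / 2) ≤ d * (f z + 24 * a * r) := by
      rw [havg] at h1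
      have := mul_le_mul_of_nonneg_left hhalf htr
      linarith
    have h3 := le_of_mul_le_mul_left h2 hd
    linarith
  have hprod : μ {z | f z < M.trace / 2 - 24 * a * r}
      = (μ.prod μ) ({z | f z < M.trace / 2 - 24 * a * r} ×ˢ Set.univ) := by
    rw [Measure.prod_prod, measure_univ, mul_one]
  rw [hprod]
  refine (measure_mono hcover).trans ((measure_iUnion_fintype_le _ _).trans ?_)
  have hj : ∀ j, (μ.prod μ) ((Prod.map id (mulSample (O j))) ⁻¹' bad)
      ≤ ENNReal.ofReal (4 * Real.exp (-t)) := fun j => by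
    rw [((MeasurePreserving.id μ).prod (measurePreserving_mulSample (hO j))).measure_preimage
      hbadm.nullMeasurableSet]
    exact hbadle
  refine (Finset.sum_le_sum fun j _ => hj j).trans (le_of_eq ?_)
  rw [Finset.sum_const, Finset.card_univ, Fintype.card_fin, nsmul_eq_mul, ← ENNReal.ofReal_natCast,
    ← ENNReal.ofReal_mul (by positivity)]
  congr 1
  ring

/-! ### The excess risk -/

theorem qmleRisk_mulSample {T T' : Matrix (Fin d) (Fin d) ℝ} (hT : Tᵀ = T) (hT' : T'ᵀ = T')
    (z : Fin m → EuclideanSpace ℝ (Fin d)) (w : Fin n → EuclideanSpace ℝ (Fin d))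
    (π : Equiv.Perm (Fin d)) :
    qmleRisk (mulSample T z) (mulSample T' w) π
      = (T' * (permute T π)⁻¹ * permute (sampleCov z)⁻¹ π * (T' * (permute T π)⁻¹)ᵀ
          * sampleCov w).trace := by
  have hp : (permute T π)ᵀ = permute T π := by rw [permute_transpose, hT]
  have h1 : (permute (T * sampleCov z * T) π)⁻¹
      = (permute T π)⁻¹ * permute (sampleCov z)⁻¹ π * (permute T π)⁻¹ := by
    rw [permute_mul, permute_mul, permute_inv, Matrix.mul_inv_rev, Matrix.mul_inv_rev, mul_assoc]
  have h2 : ((permute T π)⁻¹ * permute (sampleCov z)⁻¹ π * (permute T π)⁻¹)ᵀ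
      = (permute T π)⁻¹ * permute (sampleCov z)⁻¹ π * (permute T π)⁻¹ := by
    rw [transpose_mul, transpose_mul, transpose_nonsing_inv, hp, permute_transpose,
      transpose_nonsing_inv, sampleCov_transpose, mul_assoc]
  rw [qmleRisk, sampleCov_mulSample, sampleCov_mulSample, hT, hT', h1, matInner, h2, transpose_mul,
    transpose_nonsing_inv, hp, hT', trace_mul_comm]
  set A := (permute T π)⁻¹
  set B := permute (sampleCov z)⁻¹ π
  calc (A * B * A * (T' * sampleCov w * T')).trace
      = (A * B * A * (T' * sampleCov w) * T').trace := by simp only [mul_assoc]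
    _ = (T' * (A * B * A * (T' * sampleCov w))).trace := trace_mul_comm _ _
    _ = _ := by simp only [mul_assoc]

/-- The direction in which the fluctuation of `Σ̂_Y` enters the excess risk. -/
noncomputable def riskDirection (Q : Matrix (Fin d) (Fin d) ℝ) (π π' : Equiv.Perm (Fin d))
    (z : Fin m → EuclideanSpace ℝ (Fin d)) : Matrix (Fin d) (Fin d) ℝ :=
  Q * permute (sampleCov z)⁻¹ π * Qᵀ - permute (sampleCov z)⁻¹ π'

/-- The whitened risk is linear in `sampleCov w`, which is split as `1` plus a fluctuation. In the
term coming from `1`, relabelling by `π.symm` leaves a deterministic matrix paired with the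
unpermuted `(sampleCov z)⁻¹`. -/
theorem qmleRisk_sub_qmleRisk {T : Matrix (Fin d) (Fin d) ℝ} (hT : Tᵀ = T) (hTdet : IsUnit T.det)
    (z : Fin m → EuclideanSpace ℝ (Fin d)) (w : Fin n → EuclideanSpace ℝ (Fin d))
    (π π' : Equiv.Perm (Fin d)) {Q : Matrix (Fin d) (Fin d) ℝ}
    (hQ : Q = permute T π' * (permute T π)⁻¹) :
    qmleRisk (mulSample T z) (mulSample (permute T π') w) π
        - qmleRisk (mulSample T z) (mulSample (permute T π') w) π'
      = (permute (Qᵀ * Q - 1) π.symm * (sampleCov z)⁻¹).trace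
        + (riskDirection Q π π' z * (sampleCov w - 1)).trace := by
  have hp : (permute T π')ᵀ = permute T π' := by rw [permute_transpose, hT]
  rw [qmleRisk_mulSample hT hp, qmleRisk_mulSample hT hp, ← hQ, Matrix.mul_nonsing_inv _
    (by rwa [det_permute]), transpose_one, one_mul, mul_one,
    ← trace_permute (permute (Qᵀ * Q - 1) π.symm * _) π, permute_mul (permute _ π.symm),
    permute_symm_permute, riskDirection]
  have h1 : (Qᵀ * Q * permute (sampleCov z)⁻¹ π).trace
      = (Q * permute (sampleCov z)⁻¹ π * Qᵀ).trace := by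
    rw [mul_assoc, trace_mul_comm]
  simp only [sub_mul, mul_sub, mul_one, one_mul, trace_sub, h1, trace_permute]
  ring

theorem frobNorm_mul_transpose_sub_one (Q : Matrix (Fin d) (Fin d) ℝ) :
    frobNorm (Q * Qᵀ - 1) = frobNorm (Qᵀ * Q - 1) := by
  rw [← sq_eq_sq₀ (frobNorm_nonneg _) (frobNorm_nonneg _), frobNorm_sq_eq_trace,
    frobNorm_sq_eq_trace]
  simp only [transpose_sub, transpose_mul, transpose_transpose, transpose_one, sub_mul, mul_sub,
    mul_one, one_mul, trace_sub]
  rw [trace_mul_comm Q Qᵀ, mul_assoc Q, trace_mul_comm Q]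
  simp only [mul_assoc]

/-- The squared norm is `Tr((G QᵀQ)²)`, at most `‖G QᵀQ‖_F²` by Cauchy–Schwarz. Thus `Q` enters only
through `QᵀQ - 1`, and no separate bound on `‖Q‖` is required. -/
theorem frobNorm_conj_le (Q : Matrix (Fin d) (Fin d) ℝ) {G : Matrix (Fin d) (Fin d) ℝ}
    (hG : Gᵀ = G) :
    frobNorm (Q * G * Qᵀ) ≤ frobNorm G * (1 + frobNorm (Qᵀ * Q - 1)) := by
  have h1 : frobNorm (G * (Qᵀ * Q)) ≤ frobNorm G * (1 + frobNorm (Qᵀ * Q - 1)) := by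
    have h2 : G * (Qᵀ * Q) = G + G * (Qᵀ * Q - 1) := by rw [mul_sub, mul_one]; abel
    rw [h2, mul_add, mul_one]
    exact (frobNorm_add_le _ _).trans (add_le_add_right (frobNorm_mul_le _ _) _)
  have h3 : frobNorm (Q * G * Qᵀ) ^ 2 ≤ frobNorm (G * (Qᵀ * Q)) ^ 2 := by
    have h4 : frobNorm (Q * G * Qᵀ) ^ 2 = (G * (Qᵀ * Q) * (G * (Qᵀ * Q))).trace := by
      rw [frobNorm_sq_eq_trace, transpose_mul, transpose_mul, transpose_transpose, hG]
      calc (Q * G * Qᵀ * (Q * (G * Qᵀ))).trace = (Q * (G * Qᵀ * Q * G * Qᵀ)).trace := by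
            simp only [mul_assoc]
        _ = (G * Qᵀ * Q * G * Qᵀ * Q).trace := trace_mul_comm _ _
        _ = _ := by simp only [mul_assoc]
    rw [h4, sq]
    exact (le_abs_self _).trans (abs_trace_mul_le _ _)
  exact ((sq_le_sq₀ (frobNorm_nonneg _) (frobNorm_nonneg _)).1 h3).trans h1

/-- Split `(sampleCov z)⁻¹ = 1 + G`. The identities leave only `Q Qᵀ - 1`, which has the same
Frobenius norm as `QᵀQ - 1`; the rest is conjugates and permutations of `G`. -/
theorem frobNorm_riskDirection_le (Q : Matrix (Fin d) (Fin d) ℝ) (π π' : Equiv.Perm (Fin d))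
    (z : Fin m → EuclideanSpace ℝ (Fin d)) :
    frobNorm (riskDirection Q π π' z) ≤ frobNorm (Qᵀ * Q - 1)
      + frobNorm ((sampleCov z)⁻¹ - 1) * (2 + frobNorm (Qᵀ * Q - 1)) := by
  have hsym : ((sampleCov z)⁻¹ - 1)ᵀ = (sampleCov z)⁻¹ - 1 := by
    rw [transpose_sub, transpose_nonsing_inv, sampleCov_transpose, transpose_one]
  have h1 : riskDirection Q π π' z = ((Q * Qᵀ - 1) + Q * permute ((sampleCov z)⁻¹ - 1) π * Qᵀ)
      - permute ((sampleCov z)⁻¹ - 1) π' := by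
    rw [riskDirection, permute_sub, permute_sub, permute_one, permute_one, mul_sub, sub_mul,
      mul_one]
    abel
  have h2 := frobNorm_conj_le Q (G := permute ((sampleCov z)⁻¹ - 1) π)
    (by rw [permute_transpose, hsym])
  rw [frobNorm_permute] at h2
  rw [h1]
  refine (frobNorm_sub_le _ _).trans ?_
  rw [frobNorm_permute]
  have h3 := frobNorm_add_le (Q * Qᵀ - 1) (Q * permute ((sampleCov z)⁻¹ - 1) π * Qᵀ)
  rw [frobNorm_mul_transpose_sub_one] at h3
  linarith

theorem posDef_transpose_mul_self {Q : Matrix (Fin d) (Fin d) ℝ} (hQ : IsUnit Q.det) :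
    (Qᵀ * Q).PosDef := by
  rw [← conjTranspose_eq_transpose_of_trivial]
  exact Matrix.PosDef.conjTranspose_mul_self Q
    (Matrix.mulVec_injective_iff_isUnit.2 ((Matrix.isUnit_iff_isUnit_det _).2 hQ))

/-- Multiplying out, `T^π (QᵀQ - 1) T^π` is the difference of the permuted copies of `T * T`, and
`‖T‖² = ‖T * T‖ ≤ 1`. -/
theorem frobNorm_permute_sub_le {T : Matrix (Fin d) (Fin d) ℝ} (hT : Tᵀ = T)
    (hTdet : IsUnit T.det) (hT1 : ‖T * T‖ ≤ 1) (π π' : Equiv.Perm (Fin d))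
    {Q : Matrix (Fin d) (Fin d) ℝ} (hQ : Q = permute T π' * (permute T π)⁻¹) :
    frobNorm (permute (T * T) π - permute (T * T) π') ≤ frobNorm (Qᵀ * Q - 1) := by
  have hp : ∀ σ, (permute T σ)ᵀ = permute T σ := fun σ => by rw [permute_transpose, hT]
  have hu : IsUnit (permute T π).det := by rwa [det_permute]
  have hTT : ‖T‖ * ‖T‖ ≤ 1 := by
    have := Matrix.l2_opNorm_conjTranspose_mul_self T
    rw [conjTranspose_eq_transpose_of_trivial, hT] at this
    rwa [← this]
  have h1 : permute (T * T) π' - permute (T * T) π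
      = permute (T * permute (Qᵀ * Q - 1) π.symm * T) π := by
    simp only [permute_mul, permute_symm_permute]
    rw [hQ, transpose_mul, transpose_nonsing_inv, hp, hp, mul_sub, sub_mul, mul_one]
    congr 1
    calc permute T π' * permute T π' = 1 * permute T π' * permute T π' * 1 := by simp
      _ = (permute T π * (permute T π)⁻¹) * permute T π' * permute T π'
          * ((permute T π)⁻¹ * permute T π) := by
          rw [Matrix.mul_nonsing_inv _ hu, Matrix.nonsing_inv_mul _ hu]
      _ = _ := by simp only [mul_assoc]
  rw [← frobNorm_neg, neg_sub, h1, frobNorm_permute]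
  calc frobNorm (T * permute (Qᵀ * Q - 1) π.symm * T)
      ≤ frobNorm (T * permute (Qᵀ * Q - 1) π.symm) * ‖T‖ := frobNorm_mul_le_mul_opNorm _ _
    _ ≤ (‖T‖ * frobNorm (permute (Qᵀ * Q - 1) π.symm)) * ‖T‖ :=
        mul_le_mul_of_nonneg_right (frobNorm_mul_le_opNorm_mul _ _) (norm_nonneg _)
    _ = (‖T‖ * ‖T‖) * frobNorm (Qᵀ * Q - 1) := by rw [frobNorm_permute]; ring
    _ ≤ 1 * frobNorm (Qᵀ * Q - 1) := mul_le_mul_of_nonneg_right hTT (frobNorm_nonneg _)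
    _ = _ := one_mul _

/-! ### Fluctuations of the second sample -/

theorem measurable_riskDirection (Q : Matrix (Fin d) (Fin d) ℝ) (π π' : Equiv.Perm (Fin d))
    (i j : Fin d) :
    Measurable fun z : Fin m → EuclideanSpace ℝ (Fin d) => riskDirection Q π π' z i j := by
  simp only [riskDirection, Matrix.sub_apply, Matrix.mul_apply, permute, Matrix.of_apply]
  exact (Finset.measurable_sum _ fun k _ => (Finset.measurable_sum _ fun l _ =>
    (measurable_inv_sampleCov _ _).const_mul _).mul_const _).sub (measurable_inv_sampleCov _ _)

/-- `D` is a function of the first sample only, so by Fubini the fixed-direction Bernstein bound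
applies slice by slice. -/
theorem measure_prod_lt_trace_mul_sampleCov_sub_one_le
    {D : (Fin m → EuclideanSpace ℝ (Fin d)) → Matrix (Fin d) (Fin d) ℝ}
    (hD : ∀ i j, Measurable fun z => D z i j) (hn : 0 < n) {t : ℝ} (ht : 0 ≤ t) (htn : t ≤ n) :
    ((gaussianSample d m).prod (gaussianSample d n))
      {p | 5 * frobNorm (D p.1) * √(t / n) < -(D p.1 * (sampleCov p.2 - 1)).trace}
      ≤ ENNReal.ofReal (Real.exp (-t)) := by
  have hcov : ∀ i j, Measurable fun w : Fin n → EuclideanSpace ℝ (Fin d) =>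
      (sampleCov w - 1) i j := fun i j =>
    ((continuous_sampleCov.sub continuous_const).matrix_elem i j).measurable
  have hfrob : Measurable fun z => frobNorm (D z) := by
    simp only [frobNorm, matInner_eq_sum]
    exact (Finset.measurable_sum _ fun i _ => Finset.measurable_sum _ fun j _ =>
      (hD i j).mul (hD i j)).sqrt
  have hmeas : MeasurableSet {p : (Fin m → EuclideanSpace ℝ (Fin d)) ×
      (Fin n → EuclideanSpace ℝ (Fin d)) |
      5 * frobNorm (D p.1) * √(t / n) < -(D p.1 * (sampleCov p.2 - 1)).trace} := by
    refine measurableSet_lt (((hfrob.comp measurable_fst).const_mul _).mul_const _) ?_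
    simp only [Matrix.trace, Matrix.diag, Matrix.mul_apply]
    exact (Finset.measurable_sum _ fun i _ => Finset.measurable_sum _ fun j _ =>
      ((hD i j).comp measurable_fst).mul ((hcov j i).comp measurable_snd)).neg
  rw [Measure.prod_apply hmeas]
  refine (lintegral_mono fun z => ?_).trans
    (le_of_eq (by rw [lintegral_const, measure_univ, mul_one]) :
      ∫⁻ _, ENNReal.ofReal (Real.exp (-t)) ∂(gaussianSample d m) ≤ _)
  refine (measure_mono fun w hw => ?_).trans
    (measure_lt_trace_mul_sampleCov_sub_one_le (-(D z)) hn ht htn)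
  simpa [frobNorm_neg] using hw

/-! ### Whitening -/

/-- The Gaussian law is built from `CFC.sqrt S`. Any symmetric invertible root `T` differs from it
by the orthogonal factor `T⁻¹ * CFC.sqrt S`, so a permuted root can whiten the second sample. -/
theorem map_inv_mul_multivariateGaussian {S T : Matrix (Fin d) (Fin d) ℝ} (hS : S.PosSemidef)
    (hT : Tᵀ = T) (hTdet : IsUnit T.det) (hTS : T * T = S) :
    (multivariateGaussian 0 S).map (Matrix.toEuclideanCLM (n := Fin d) (𝕜 := ℝ) T⁻¹)
      = stdGaussian (EuclideanSpace ℝ (Fin d)) := by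
  open scoped MatrixOrder in
  have hsq : CFC.sqrt S * CFC.sqrt S = S := CFC.sqrt_mul_sqrt_self _ hS.nonneg
  open scoped MatrixOrder in
  have hsa : (CFC.sqrt S)ᵀ = CFC.sqrt S := by
    have := (CFC.sqrt_nonneg S).isSelfAdjoint
    rwa [IsSelfAdjoint, star_eq_conjTranspose, conjTranspose_eq_transpose_of_trivial] at this
  have hU : (T⁻¹ * CFC.sqrt S) * (T⁻¹ * CFC.sqrt S)ᵀ = 1 := by
    rw [transpose_mul, hsa, transpose_nonsing_inv, hT]
    calc T⁻¹ * CFC.sqrt S * (CFC.sqrt S * T⁻¹) = T⁻¹ * (CFC.sqrt S * CFC.sqrt S) * T⁻¹ := by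
          simp only [mul_assoc]
      _ = (T⁻¹ * T) * (T * T⁻¹) := by rw [hsq, ← hTS]; simp only [mul_assoc]
      _ = 1 := by rw [Matrix.nonsing_inv_mul _ hTdet, Matrix.mul_nonsing_inv _ hTdet, one_mul]
  rw [multivariateGaussian, Measure.map_map (by fun_prop) (by fun_prop),
    show (Matrix.toEuclideanCLM (n := Fin d) (𝕜 := ℝ) T⁻¹) ∘
      (fun x => 0 + Matrix.toEuclideanCLM (n := Fin d) (𝕜 := ℝ) (CFC.sqrt S) x)
      = Matrix.toEuclideanCLM (n := Fin d) (𝕜 := ℝ) (T⁻¹ * CFC.sqrt S) by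
        funext x; simp [map_mul], map_toEuclideanCLM_stdGaussian hU]

theorem map_mulSample_inv {Ω : Type*} [MeasurableSpace Ω] {P : Measure Ω} [IsProbabilityMeasure P]
    {S T : Matrix (Fin d) (Fin d) ℝ} (hS : S.PosSemidef) (hT : Tᵀ = T) (hTdet : IsUnit T.det)
    (hTS : T * T = S) {X : Fin m → Ω → EuclideanSpace ℝ (Fin d)}
    (hlaw : ∀ k, HasLaw (X k) (multivariateGaussian 0 S) P) (hindep : iIndepFun X P) :
    P.map (fun ω => mulSample T⁻¹ fun k => X k ω) = gaussianSample d m := by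
  have h1 : P.map (fun ω k => X k ω) = Measure.pi fun _ : Fin m => multivariateGaussian 0 S := by
    rw [(iIndepFun_iff_map_fun_eq_pi_map fun k => (hlaw k).aemeasurable).1 hindep]
    simp only [(hlaw _).map_eq]
  have hmeas : Measurable (mulSample (m := m) T⁻¹) :=
    measurable_pi_lambda _ fun k => by unfold mulSample; fun_prop
  have h2 := AEMeasurable.map_map_of_aemeasurable (μ := P) (f := fun ω k => X k ω)
    hmeas.aemeasurable (aemeasurable_pi_lambda _ fun k => (hlaw k).aemeasurable)
  rw [Function.comp_def] at h2
  rw [← h2, h1]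
  exact (measurePreserving_pi _ _ fun _ =>
    ⟨by fun_prop, map_inv_mul_multivariateGaussian hS hT hTdet hTS⟩).map_eq

/-! ### The risk bound -/

/-- With `k = √K` one has `a ≤ 3k + 2k²`. The term in `k² E` is absorbed because `E` is tiny and the
one in `k E` by the arithmetic–geometric mean inequality, so `K ≲ u² + v² + r`. In particular `K ≤
1`, and then `a² ≤ 12 K`. -/
theorem sq_le_of_basic_inequality {K a u v r : ℝ} (hK : 0 ≤ K) (ha : 0 ≤ a) (hu : 0 ≤ u)
    (hv : 0 ≤ v) (hr : 0 ≤ r) (hu1 : u ≤ 1 / 10 ^ 12) (hv1 : v ≤ 1 / 10 ^ 12)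
    (hr1 : r ≤ 1 / 10 ^ 12) (haK : a ^ 2 ≤ 8 * K + 4 * K ^ 2)
    (h : K / 2 ≤ 72 * a * (u + v) + 3600 * r + 1800 * a * r) :
    a ^ 2 ≤ 10 ^ 11 * (u ^ 2 + v ^ 2 + r) := by
  obtain ⟨k, hk, rfl⟩ : ∃ k, 0 ≤ k ∧ k ^ 2 = K := ⟨√K, Real.sqrt_nonneg _, Real.sq_sqrt hK⟩
  have hak : a ≤ 3 * k + 2 * k ^ 2 := by
    refine abs_le_of_sq_le_sq' ?_ (by positivity) |>.2
    nlinarith [pow_nonneg hk 3, sq_nonneg k]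
  set E := u + v + r with hE
  have hE0 : 0 ≤ E := by positivity
  have hE1 : E ≤ 3 / 10 ^ 12 := by rw [hE]; linarith
  have hE2 : E ^ 2 ≤ 3 * (u ^ 2 + v ^ 2 + r) := by
    have : r ^ 2 ≤ r := by nlinarith
    nlinarith [sq_nonneg (u - v), sq_nonneg (u - r), sq_nonneg (v - r)]
  have h1 : k ^ 2 / 2 ≤ 1800 * (a * E) + 3600 * r := by
    have := mul_nonneg ha (add_nonneg hu hv)
    rw [hE]
    linarith
  have h2 : a * E ≤ 3 * (k * E) + 2 * (k ^ 2 * E) := by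
    have := mul_le_mul_of_nonneg_right hak hE0
    linarith
  have h3 : k ^ 2 * E ≤ k ^ 2 * (3 / 10 ^ 12) := mul_le_mul_of_nonneg_left hE1 (sq_nonneg k)
  have h4 : 5400 * (k * E) ≤ k ^ 2 / 8 + 2 * 5400 ^ 2 * E ^ 2 := by
    nlinarith [sq_nonneg (k - 4 * 5400 * E)]
  have h5 : k ^ 2 ≤ 10 ^ 9 * (u ^ 2 + v ^ 2 + r) := by
    nlinarith [sq_nonneg u, sq_nonneg v]
  have h6 : k ^ 2 ≤ 1 := by
    have : u ^ 2 + v ^ 2 + r ≤ 3 / 10 ^ 12 := by nlinarith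
    linarith
  nlinarith [sq_nonneg k]

theorem log_term_bounds (hd : 2 ≤ d) :
    1 ≤ d * Real.log d ∧ (d : ℝ) ≤ 2 * (d * Real.log d) ∧
      (d : ℝ) ≤ Real.exp (d * Real.log d) ∧
      ((Fintype.card (Equiv.Perm (Fin d)) : ℕ) : ℝ) ≤ Real.exp (d * Real.log d) := by
  have hd2 : (2 : ℝ) ≤ d := by exact_mod_cast hd
  have hd0 : (0 : ℝ) < d := by linarith
  have hlog : 0.69 ≤ Real.log d :=
    (by linarith [Real.log_two_gt_d9] : (0.69 : ℝ) ≤ Real.log 2).trans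
      (Real.log_le_log (by norm_num) hd2)
  refine ⟨by nlinarith, by nlinarith, ?_, ?_⟩
  · calc (d : ℝ) = Real.exp (Real.log d) := (Real.exp_log hd0).symm
      _ ≤ _ := Real.exp_le_exp.2 (by nlinarith)
  · rw [Fintype.card_perm, Fintype.card_fin, Real.exp_nat_mul, Real.exp_log hd0]
    exact_mod_cast Nat.factorial_le_pow d

/-- With `x = d log d`, the factors `d!`, `d` and `16` are at most `exp x`, `exp x` and `exp (3x)`,
which the level `5 (x + log (1/δ))` absorbs. -/
theorem union_bound_le (hd : 2 ≤ d) {δ : ℝ} (hδ : 0 < δ) (hδ1 : δ < 1) :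
    ((Fintype.card (Equiv.Perm (Fin d)) : ℕ) : ℝ) *
      (4 * d * Real.exp (-(5 * (d * Real.log d + Real.log (1 / δ))))) ≤ δ / 4 := by
  obtain ⟨hx1, -, hdx, hcard⟩ := log_term_bounds hd
  set x := d * Real.log d
  have hL : 0 ≤ Real.log (1 / δ) := Real.log_nonneg (by rw [le_div_iff₀ hδ]; linarith)
  have hδe : δ = Real.exp (-Real.log (1 / δ)) := by
    rw [one_div, Real.log_inv, neg_neg, Real.exp_log hδ]
  have h16 : (16 : ℝ) ≤ Real.exp (3 * x) := by
    have h1 : (2.7 : ℝ) ≤ Real.exp 1 := by linarith [Real.exp_one_gt_d9]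
    calc (16 : ℝ) ≤ 2.7 ^ 3 := by norm_num
      _ ≤ Real.exp 1 ^ 3 := pow_le_pow_left₀ (by norm_num) h1 3
      _ = Real.exp 3 := by rw [← Real.exp_nat_mul]; norm_num
      _ ≤ Real.exp (3 * x) := Real.exp_le_exp.2 (by linarith)
  set N := ((Fintype.card (Equiv.Perm (Fin d)) : ℕ) : ℝ)
  have hN : 0 ≤ N := Nat.cast_nonneg _
  set y := Real.exp (-(5 * (x + Real.log (1 / δ))))
  have hy : 0 ≤ y := (Real.exp_pos _).le
  have h1 : N * d * 16 * y ≤ Real.exp x * Real.exp x * Real.exp (3 * x) * y := by gcongr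
  have h2 : Real.exp x * Real.exp x * Real.exp (3 * x) * y ≤ δ := by
    conv_rhs => rw [hδe]
    simp only [y, ← Real.exp_add]
    exact Real.exp_le_exp.2 (by linarith)
  linarith

theorem measure_iUnion_le_ofReal {α ι : Type*} [MeasurableSpace α] [Fintype ι] (μ : Measure α)
    {B : ι → Set α} {b c : ℝ} (h : ∀ i, μ (B i) ≤ ENNReal.ofReal b)
    (hc : (Fintype.card ι : ℝ) * b ≤ c) : μ (⋃ i, B i) ≤ ENNReal.ofReal c := by
  refine (measure_iUnion_fintype_le _ _).trans ((Finset.sum_le_sum fun i _ => h i).trans ?_)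
  rw [Finset.sum_const, nsmul_eq_mul, Finset.card_univ, ← ENNReal.ofReal_natCast,
    ← ENNReal.ofReal_mul (Nat.cast_nonneg _)]
  exact ENNReal.ofReal_le_ofReal hc

theorem posDef_and_det_eq_one {T : Matrix (Fin d) (Fin d) ℝ} (hTdet : IsUnit T.det)
    (π π' : Equiv.Perm (Fin d)) {Q : Matrix (Fin d) (Fin d) ℝ}
    (hQ : Q = permute T π' * (permute T π)⁻¹) : (Qᵀ * Q).PosDef ∧ (Qᵀ * Q).det = 1 := by
  have hQdet : Q.det = 1 := by
    rw [hQ, det_mul, det_nonsing_inv, det_permute, det_permute, Ring.inverse_eq_inv',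
      mul_inv_cancel₀ hTdet.ne_zero]
  exact ⟨posDef_transpose_mul_self (by rw [hQdet]; exact isUnit_one),
    by rw [det_mul, det_transpose, hQdet, one_mul]⟩

/-- The risk bound on the event where the relevant fluctuations are small. -/
theorem frobNorm_sq_le_of_isQMLE {T : Matrix (Fin d) (Fin d) ℝ} (hT : Tᵀ = T)
    (hTdet : IsUnit T.det) (hT1 : ‖T * T‖ ≤ 1) (hm : 0 < m) (hn : 0 < n)
    {τ κ κ' : ℝ} (hτ : 0 ≤ τ) (hκ' : 0 ≤ κ') (hκκ' : κ' ≤ 2 * κ)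
    (hτm : 10 ^ 24 * τ ≤ m) (hκm : 12800 * κ ≤ m) (hτn : 10 ^ 24 * τ ≤ n)
    (hmn : 10 ^ 24 * (d * τ * κ) ≤ (m : ℝ) * n) (π π' : Equiv.Perm (Fin d))
    {Q : Matrix (Fin d) (Fin d) ℝ} (hQ : Q = permute T π' * (permute T π)⁻¹)
    {z : Fin m → EuclideanSpace ℝ (Fin d)} {w : Fin n → EuclideanSpace ℝ (Fin d)}
    (hop : ‖sampleCov z - 1‖ ≤ 40 * √(κ' / m))
    (hz : (permute (Qᵀ * Q - 1) π.symm).trace / 2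
      - 24 * frobNorm (permute (Qᵀ * Q - 1) π.symm) * √(5 * τ / m)
      ≤ (permute (Qᵀ * Q - 1) π.symm * (sampleCov z)⁻¹).trace)
    (hw : -(riskDirection Q π π' z * (sampleCov w - 1)).trace
      ≤ 5 * frobNorm (riskDirection Q π π' z) * √(5 * τ / n))
    (hπ : IsQMLE (mulSample T z) (mulSample (permute T π') w) π) :
    frobNorm (permute (T * T) π - permute (T * T) π') ^ 2
      ≤ 10 ^ 11 * (τ / m + τ / n + √(d * τ * κ / (m * n))) := by
  have hm' : (0 : ℝ) < m := by positivity
  have hn' : (0 : ℝ) < n := by positivity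
  have hκ : 0 ≤ κ := by linarith
  obtain ⟨hpos, hdet⟩ := posDef_and_det_eq_one hTdet π π' hQ
  obtain ⟨hK, haK⟩ := frobNorm_sq_sub_one_le hpos hdet
  have hle := frobNorm_permute_sub_le hT hTdet hT1 π π' hQ
  rw [trace_permute, frobNorm_permute] at hz
  have hexc := qmleRisk_sub_qmleRisk hT hTdet z w π π' hQ
  have hD := frobNorm_riskDirection_le Q π π' z
  set K := (Qᵀ * Q - 1).trace
  set a := frobNorm (Qᵀ * Q - 1)
  have ha : 0 ≤ a := frobNorm_nonneg _
  set g := frobNorm ((sampleCov z)⁻¹ - 1)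
  set r := √(d * τ * κ / (m * n)) with hr
  set u := √(τ / m) with hu
  set v := √(τ / n) with hv
  have hs5 : √5 ≤ 3 := by rw [Real.sqrt_le_left (by norm_num)]; norm_num
  have hu5 : √(5 * τ / m) ≤ 3 * u := by
    rw [mul_div_assoc, Real.sqrt_mul (by norm_num)]
    exact mul_le_mul_of_nonneg_right hs5 (Real.sqrt_nonneg _)
  have hv5 : √(5 * τ / n) ≤ 3 * v := by
    rw [mul_div_assoc, Real.sqrt_mul (by norm_num)]
    exact mul_le_mul_of_nonneg_right hs5 (Real.sqrt_nonneg _)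
  -- The factor `3 / 2` dominates `√2`.
  have hκ2 : √(κ' / m) ≤ 3 / 2 * √(κ / m) := by
    rw [Real.sqrt_le_left (by positivity), mul_pow, Real.sq_sqrt (by positivity), ← mul_div_assoc]
    gcongr
    linarith
  have hhalf : ‖sampleCov z - 1‖ ≤ 1 / 2 := by
    have h1 : √(κ' / m) ≤ 1 / 80 := by
      rw [Real.sqrt_le_left (by norm_num), div_le_iff₀ hm']
      linarith
    linarith
  have hg : g ≤ 120 * (√d * √(κ / m)) := by
    have h1 := (frobNorm_le_sqrt_mul_opNorm ((sampleCov z)⁻¹ - 1)).trans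
      (mul_le_mul_of_nonneg_left (norm_inv_sub_one_le hhalf) (Real.sqrt_nonneg _))
    have h2 : ‖sampleCov z - 1‖ ≤ 60 * √(κ / m) := by linarith
    have h3 := mul_le_mul_of_nonneg_left h2 (Real.sqrt_nonneg (d : ℝ))
    linarith
  -- Origin of the square root term of the rate: the error in the first sample's inverse covariance
  -- multiplies the noise of the second sample.
  have hgv : g * v ≤ 120 * r := by
    have h1 := mul_le_mul_of_nonneg_right hg (Real.sqrt_nonneg (τ / n))
    have h2 : √d * √(κ / m) * √(τ / n) = r := by
      rw [← Real.sqrt_mul (by positivity), ← Real.sqrt_mul (by positivity), hr]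
      congr 1
      field_simp
    rw [mul_assoc 120, h2] at h1
    exact h1
  -- The sample size constant `10 ^ 24` is the square of the smallness `10 ^ 12` needed for
  -- absorption.
  have hsmall : ∀ {x : ℝ}, x ≤ 1 / 10 ^ 24 → √x ≤ 1 / 10 ^ 12 := fun hx => by
    rw [Real.sqrt_le_left (by norm_num)]
    exact hx.trans (by norm_num)
  have hu1 : u ≤ 1 / 10 ^ 12 := hsmall (by rw [div_le_iff₀ hm']; linarith)
  have hv1 : v ≤ 1 / 10 ^ 12 := hsmall (by rw [div_le_iff₀ hn']; linarith)
  have hr1 : r ≤ 1 / 10 ^ 12 := hsmall (by rw [div_le_iff₀ (by positivity)]; linarith)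
  have hu0 : 0 ≤ u := Real.sqrt_nonneg _
  have hv0 : 0 ≤ v := Real.sqrt_nonneg _
  have hr0 : 0 ≤ r := Real.sqrt_nonneg _
  have hrisk := hπ π'
  have hbasic : K / 2 ≤ 72 * a * (u + v) + 3600 * r + 1800 * a * r := by
    have h1 : 24 * a * √(5 * τ / m) ≤ 24 * a * (3 * u) :=
      mul_le_mul_of_nonneg_left hu5 (by positivity)
    have h2 : 5 * frobNorm (riskDirection Q π π' z) * √(5 * τ / n)
        ≤ 5 * (a + g * (2 + a)) * (3 * v) :=
      mul_le_mul (mul_le_mul_of_nonneg_left hD (by norm_num)) hv5 (Real.sqrt_nonneg _)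
        (by have := frobNorm_nonneg ((sampleCov z)⁻¹ - 1); positivity)
    have h3 : (2 + a) * (g * v) ≤ (2 + a) * (120 * r) :=
      mul_le_mul_of_nonneg_left hgv (by positivity)
    have h4 := mul_nonneg ha hv0
    linarith
  have hfin := sq_le_of_basic_inequality hK ha hu0 hv0 hr0 hu1 hv1 hr1 haK hbasic
  rw [hu, hv, Real.sq_sqrt (by positivity), Real.sq_sqrt (by positivity)] at hfin
  exact (pow_le_pow_left₀ (frobNorm_nonneg _) hle 2).trans hfin

/-- The risk bound with high probability, for whitened samples. -/
theorem measure_isQMLE_lt_le (hd : 2 ≤ d) {δ : ℝ} (hδ : 0 < δ) (hδ1 : δ < 1)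
    {T : Matrix (Fin d) (Fin d) ℝ} (hT : Tᵀ = T) (hTdet : IsUnit T.det) (hT1 : ‖T * T‖ ≤ 1)
    (π' : Equiv.Perm (Fin d))
    (hm : 10 ^ 24 * (d * Real.log d + Real.log (1 / δ)) ≤ (m : ℝ))
    (hn : 10 ^ 24 * (d * Real.log d + Real.log (1 / δ)) ≤ (n : ℝ))
    (hmn : 10 ^ 24 * (d * (d * Real.log d + Real.log (1 / δ)) * (d + Real.log (1 / δ)))
      ≤ (m : ℝ) * n) :
    ((gaussianSample d m).prod (gaussianSample d n)) {p | ∃ π : Equiv.Perm (Fin d),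
      IsQMLE (mulSample T p.1) (mulSample (permute T π') p.2) π ∧
        10 ^ 11 * ((d * Real.log d + Real.log (1 / δ)) / m
          + (d * Real.log d + Real.log (1 / δ)) / n
          + √(d * (d * Real.log d + Real.log (1 / δ)) * (d + Real.log (1 / δ)) / (m * n)))
        < frobNorm (permute (T * T) π - permute (T * T) π') ^ 2} ≤ ENNReal.ofReal δ := by
  have : NeZero d := ⟨by omega⟩
  obtain ⟨hx1, hdx, -, -⟩ := log_term_bounds hd
  have hunion := union_bound_le hd hδ hδ1
  have hd2 : (2 : ℝ) ≤ d := by exact_mod_cast hd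
  have hL : 0 ≤ Real.log (1 / δ) := Real.log_nonneg (by rw [le_div_iff₀ hδ]; linarith)
  have hδe : Real.exp (-(Real.log (1 / δ) + 2)) ≤ δ / 4 := by
    have h1 : (2.7 : ℝ) ≤ Real.exp 1 := by linarith [Real.exp_one_gt_d9]
    have h2 : (4 : ℝ) ≤ Real.exp 2 := by
      calc (4 : ℝ) ≤ 2.7 ^ 2 := by norm_num
        _ ≤ Real.exp 1 ^ 2 := pow_le_pow_left₀ (by norm_num) h1 2
        _ = Real.exp 2 := by rw [← Real.exp_nat_mul]; norm_num
    rw [neg_add, Real.exp_add, one_div, Real.log_inv, neg_neg, Real.exp_log hδ, Real.exp_neg,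
      ← div_eq_mul_inv]
    exact div_le_div_of_nonneg_left hδ.le (by norm_num) h2
  set l := Real.log (1 / δ)
  set x := d * Real.log d
  set τ := x + l with hτ
  have hτ1 : 1 ≤ τ := by linarith
  have hm0 : (0 : ℝ) < m := by linarith
  have hn0 : (0 : ℝ) < n := by linarith
  have hmN : 0 < m := Nat.cast_pos.1 hm0
  have hnN : 0 < n := Nat.cast_pos.1 hn0
  let Q : Equiv.Perm (Fin d) → Matrix (Fin d) (Fin d) ℝ := fun π =>
    permute T π' * (permute T π)⁻¹
  let M : Equiv.Perm (Fin d) → Matrix (Fin d) (Fin d) ℝ := fun π =>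
    permute ((Q π)ᵀ * Q π - 1) π.symm
  have hM : ∀ π, (M π).IsHermitian := fun π => by
    rw [Matrix.IsHermitian, conjTranspose_eq_transpose_of_trivial, permute_transpose]
    simp [M]
  have hMtr : ∀ π, 0 ≤ (M π).trace := fun π => by
    obtain ⟨hpos, hdet⟩ := posDef_and_det_eq_one hTdet π π' (Q := Q π) rfl
    rw [trace_permute]
    exact (frobNorm_sq_sub_one_le hpos hdet).1
  set μ := (gaussianSample d m).prod (gaussianSample d n)
  let B₁ : Equiv.Perm (Fin d) → Set ((Fin m → EuclideanSpace ℝ (Fin d)) ×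
      (Fin n → EuclideanSpace ℝ (Fin d))) := fun π =>
    {z | (M π * (sampleCov z)⁻¹).trace
      < (M π).trace / 2 - 24 * frobNorm (M π) * √(5 * τ / m)} ×ˢ Set.univ
  let B₂ : Equiv.Perm (Fin d) → Set ((Fin m → EuclideanSpace ℝ (Fin d)) ×
      (Fin n → EuclideanSpace ℝ (Fin d))) := fun π =>
    {p | 5 * frobNorm (riskDirection (Q π) π π' p.1) * √(5 * τ / n)
      < -(riskDirection (Q π) π π' p.1 * (sampleCov p.2 - 1)).trace}
  -- No union over permutations is taken here, so the level `l + 2` suffices and the bound involves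
  -- `d + l` instead of `τ`. The shift by `2` turns `δ` into at most `δ / 4`, and `d + l + 2 ≤ 2 (d
  -- + l)` since `d ≥ 2`.
  let B₃ : Set ((Fin m → EuclideanSpace ℝ (Fin d)) × (Fin n → EuclideanSpace ℝ (Fin d))) :=
    {z | 40 * √((d + (l + 2)) / m) < ‖sampleCov z - 1‖} ×ˢ Set.univ
  have hB₁ : μ (⋃ π, B₁ π) ≤ ENNReal.ofReal (δ / 4) := by
    refine measure_iUnion_le_ofReal μ (fun π => ?_) hunion
    simp only [μ, B₁]
    rw [Measure.prod_prod, measure_univ, mul_one]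
    exact measure_trace_mul_inv_sampleCov_lt_le (hM π) (hMtr π) (by positivity) hmN (by linarith)
  have hB₂ : μ (⋃ π, B₂ π) ≤ ENNReal.ofReal (δ / 4) := by
    refine measure_iUnion_le_ofReal μ (b := Real.exp (-(5 * τ))) (fun π => ?_)
      (le_trans ?_ hunion)
    · exact measure_prod_lt_trace_mul_sampleCov_sub_one_le (measurable_riskDirection (Q π) π π')
        hnN (by positivity) (by linarith)
    · refine mul_le_mul_of_nonneg_left ?_ (Nat.cast_nonneg _)
      have := Real.exp_pos (-(5 * τ))
      nlinarith
  have hB₃ : μ B₃ ≤ ENNReal.ofReal (δ / 4) := by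
    simp only [μ, B₃]
    rw [Measure.prod_prod, measure_univ, mul_one]
    exact (measure_lt_norm_sampleCov_sub_one_le (by positivity) hmN (by linarith)).trans
      (ENNReal.ofReal_le_ofReal hδe)
  have hsub : {p : (Fin m → EuclideanSpace ℝ (Fin d)) × (Fin n → EuclideanSpace ℝ (Fin d)) |
      ∃ π : Equiv.Perm (Fin d),
        IsQMLE (mulSample T p.1) (mulSample (permute T π') p.2) π ∧
        10 ^ 11 * (τ / m + τ / n + √(d * τ * (d + l) / (m * n)))
        < frobNorm (permute (T * T) π - permute (T * T) π') ^ 2}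
      ⊆ (⋃ π, B₁ π) ∪ (⋃ π, B₂ π) ∪ B₃ := by
    rintro ⟨z, w⟩ ⟨π, hπ, hlt⟩
    by_contra hcon
    simp only [Set.mem_union, Set.mem_iUnion, not_or, not_exists] at hcon
    obtain ⟨⟨h1, h2⟩, h3⟩ := hcon
    have h1' : (M π).trace / 2 - 24 * frobNorm (M π) * √(5 * τ / m)
        ≤ (M π * (sampleCov z)⁻¹).trace := not_lt.1 fun h => h1 π (Set.mk_mem_prod h (Set.mem_univ _))
    have h2' : -(riskDirection (Q π) π π' z * (sampleCov w - 1)).trace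
        ≤ 5 * frobNorm (riskDirection (Q π) π π' z) * √(5 * τ / n) :=
      not_lt.1 fun h => h2 π h
    have h3' : ‖sampleCov z - 1‖ ≤ 40 * √((d + (l + 2)) / m) :=
      not_lt.1 fun h => h3 (Set.mk_mem_prod h (Set.mem_univ _))
    refine absurd (frobNorm_sq_le_of_isQMLE hT hTdet hT1 hmN hnN (τ := τ) (κ := d + l)
      (κ' := d + (l + 2)) (by linarith) (by positivity) (by linarith) (by linarith) (by linarith)
      (by linarith) hmn π π' rfl h3' h1' h2' hπ) (not_le.2 hlt)
  calc _ ≤ μ ((⋃ π, B₁ π) ∪ (⋃ π, B₂ π) ∪ B₃) := measure_mono hsub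
    _ ≤ (ENNReal.ofReal (δ / 4) + ENNReal.ofReal (δ / 4)) + ENNReal.ofReal (δ / 4) :=
        (measure_union_le _ _).trans
          (add_le_add ((measure_union_le _ _).trans (add_le_add hB₁ hB₂)) hB₃)
    _ ≤ ENNReal.ofReal δ := by
        rw [← ENNReal.ofReal_add (by positivity) (by positivity),
          ← ENNReal.ofReal_add (by positivity) (by positivity)]
        exact ENNReal.ofReal_le_ofReal (by linarith)

end CovAlign


/-! ### Transfer from whitened samples to the covariance alignment model -/

theorem theorem2 :
    ∃ c₀ C : ℝ, 0 < c₀ ∧ 0 < C ∧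
      ∀ (d m n : ℕ) (δ : ℝ), 0 < δ → δ < 1 →
        c₀ * (d * Real.log d + Real.log (1 / δ)) ≤ min (m : ℝ) (n : ℝ) →
        c₀ * d * (d * Real.log d + Real.log (1 / δ)) * (d + Real.log (1 / δ)) ≤ (m : ℝ) * n →
        ∀ (πstar : Equiv.Perm (Fin d)) (S : Matrix (Fin d) (Fin d) ℝ),
          S.PosDef → CovAlign.opNorm S ≤ 1 →
          ∀ {Ω : Type*} [MeasurableSpace Ω] (P : Measure Ω) [IsProbabilityMeasure P]
            (X : Fin m → Ω → EuclideanSpace ℝ (Fin d))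
            (Y : Fin n → Ω → EuclideanSpace ℝ (Fin d)),
            CovAlign.IsModel P S πstar X Y →
            1 - δ ≤ P.real {ω | ∀ πhat : Equiv.Perm (Fin d),
              CovAlign.IsQMLE (fun k => X k ω) (fun k => Y k ω) πhat →
              CovAlign.frobNorm (CovAlign.permute S πhat - CovAlign.permute S πstar) ^ 2 ≤
                C * ((d * Real.log d + Real.log (1 / δ)) / min (m : ℝ) (n : ℝ)
                  + √(d * (d * Real.log d + Real.log (1 / δ)) * (d + Real.log (1 / δ))
                      / ((m : ℝ) * n)))} := by
  open CovAlign in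
  -- The extra factor `2` comes from bounding both `τ / m` and `τ / n` by `τ / min m n`.
  refine ⟨10 ^ 24, 2 * 10 ^ 11, by norm_num, by norm_num, ?_⟩
  intro d m n δ hδ hδ1 hmin hmn π' S hS hS1 Ω _ P _ X Y hmodel
  have hL : 0 < Real.log (1 / δ) := Real.log_pos (by rw [lt_div_iff₀ hδ]; linarith)
  have hτ0 : 0 < d * Real.log d + Real.log (1 / δ) :=
    add_pos_of_nonneg_of_pos (mul_nonneg (Nat.cast_nonneg d) (Real.log_natCast_nonneg d)) hL
  have hmin0 : 0 < min (m : ℝ) n := lt_of_lt_of_le (by positivity) hmin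
  -- For `d ≤ 1` there is only one permutation and the loss vanishes; the union bound needs `d ≥ 2`,
  -- since `d log d` is zero otherwise.
  rcases lt_or_ge d 2 with hd | hd
  · have hsub : Subsingleton (Fin d) := by
      interval_cases d <;> infer_instance
    have hall : {ω | ∀ πhat : Equiv.Perm (Fin d),
        IsQMLE (fun k => X k ω) (fun k => Y k ω) πhat →
        frobNorm (permute S πhat - permute S π') ^ 2 ≤
          2 * 10 ^ 11 * ((d * Real.log d + Real.log (1 / δ)) / min (m : ℝ) (n : ℝ)
            + √(d * (d * Real.log d + Real.log (1 / δ)) * (d + Real.log (1 / δ))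
                / ((m : ℝ) * n)))} = Set.univ := by
      refine Set.eq_univ_of_forall fun ω πhat _ => ?_
      rw [Subsingleton.elim πhat π', sub_self]
      have h0 : frobNorm (0 : Matrix (Fin d) (Fin d) ℝ) = 0 := by simp [frobNorm, matInner]
      rw [h0, zero_pow two_ne_zero]
      exact mul_nonneg (by norm_num)
        (add_nonneg (div_nonneg hτ0.le hmin0.le) (Real.sqrt_nonneg _))
    rw [hall, probReal_univ]
    linarith
  set τ := d * Real.log d + Real.log (1 / δ)
  open scoped MatrixOrder in
  have hTS : CFC.sqrt S * CFC.sqrt S = S := CFC.sqrt_mul_sqrt_self _ hS.posSemidef.nonneg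
  open scoped MatrixOrder in
  have hT : (CFC.sqrt S).transpose = CFC.sqrt S := by
    have := (CFC.sqrt_nonneg S).isSelfAdjoint
    rwa [IsSelfAdjoint, Matrix.star_eq_conjTranspose,
      Matrix.conjTranspose_eq_transpose_of_trivial] at this
  set T := CFC.sqrt S
  have hTdet : IsUnit T.det := isUnit_iff_ne_zero.2 fun h => by
    have h1 := hS.det_pos
    rw [← hTS, Matrix.det_mul, h, mul_zero] at h1
    exact lt_irrefl _ h1
  have hT' : (permute T π').transpose = permute T π' := by rw [permute_transpose, hT]
  have hTdet' : IsUnit (permute T π').det := by rwa [CovAlign.det_permute]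
  have hlawX := map_mulSample_inv hS.posSemidef hT hTdet hTS hmodel.law_X hmodel.indep_X
  have hlawY := map_mulSample_inv (posDef_permute hS π').posSemidef hT' hTdet'
    (by rw [← permute_mul, hTS]) hmodel.law_Y hmodel.indep_Y
  have hmeas : ∀ {k : ℕ} (A : Matrix (Fin d) (Fin d) ℝ), Measurable (mulSample (m := k) A) :=
    fun A => measurable_pi_lambda _ fun k => by unfold mulSample; fun_prop
  have hXm : AEMeasurable (fun ω k => X k ω) P :=
    aemeasurable_pi_lambda _ fun k => (hmodel.law_X k).aemeasurable
  have hYm : AEMeasurable (fun ω k => Y k ω) P :=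
    aemeasurable_pi_lambda _ fun k => (hmodel.law_Y k).aemeasurable
  have hindep := hmodel.indep_XY.comp (hmeas (k := m) T⁻¹) (hmeas (k := n) (permute T π')⁻¹)
  have hZm := (hmeas (k := m) T⁻¹).comp_aemeasurable hXm
  have hWm := (hmeas (k := n) (permute T π')⁻¹).comp_aemeasurable hYm
  have hjoint := (indepFun_iff_map_prod_eq_prod_map_map hZm hWm).1 hindep
  simp only [Function.comp_def] at hjoint hZm hWm
  rw [hlawX, hlawY] at hjoint
  have hcancel : ∀ {k : ℕ} {A : Matrix (Fin d) (Fin d) ℝ}, IsUnit A.det →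
      ∀ x : Fin k → EuclideanSpace ℝ (Fin d), mulSample A (mulSample A⁻¹ x) = x := by
    intro k A hA x
    funext i
    change (Matrix.toEuclideanCLM (n := Fin d) (𝕜 := ℝ) A
      * Matrix.toEuclideanCLM (n := Fin d) (𝕜 := ℝ) A⁻¹) (x i) = x i
    rw [← map_mul, Matrix.mul_nonsing_inv _ hA, map_one]
    rfl
  have hbad := measure_isQMLE_lt_le hd hδ hδ1 hT hTdet (by rw [hTS]; exact hS1) π'
    (hmin.trans (min_le_left _ _)) (hmin.trans (min_le_right _ _)) (by linarith)
  rw [← hjoint] at hbad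
  -- This inequality holds for arbitrary sets, so the bad event need not be shown measurable.
  have hbad' := (Measure.le_map_apply (hZm.prodMk hWm) _).trans hbad
  set good := {ω | ∀ πhat : Equiv.Perm (Fin d),
        IsQMLE (fun k => X k ω) (fun k => Y k ω) πhat →
        frobNorm (permute S πhat - permute S π') ^ 2 ≤
          2 * 10 ^ 11 * (τ / min (m : ℝ) (n : ℝ)
            + √(d * τ * (d + Real.log (1 / δ)) / ((m : ℝ) * n)))} with hgood
  have hcompl : P goodᶜ ≤ ENNReal.ofReal δ := by
    refine (measure_mono fun ω hω => ?_).trans hbad'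
    simp only [hgood, Set.mem_compl_iff, Set.mem_ofPred_eq, not_forall, not_le] at hω
    obtain ⟨π, hπ, hlt⟩ := hω
    refine ⟨π, ?_, ?_⟩
    · simp only [hcancel hTdet, hcancel hTdet']
      exact hπ
    · rw [hTS]
      refine lt_of_le_of_lt ?_ hlt
      have h1 : τ / m ≤ τ / min (m : ℝ) n :=
        div_le_div_of_nonneg_left hτ0.le hmin0 (min_le_left _ _)
      have h2 : τ / n ≤ τ / min (m : ℝ) n :=
        div_le_div_of_nonneg_left hτ0.le hmin0 (min_le_right _ _)
      have h3 := Real.sqrt_nonneg (d * τ * (d + Real.log (1 / δ)) / ((m : ℝ) * n))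
      linarith
  -- Subadditivity alone is used, again avoiding measurability of `good`.
  have h1 : (1 : ℝ) ≤ P.real good + P.real goodᶜ := by
    rw [← probReal_univ (μ := P), ← Set.union_compl_self good]
    exact measureReal_union_le _ _
  have h2 : P.real goodᶜ ≤ δ := ENNReal.toReal_le_of_le_ofReal hδ.le hcompl
  linarith
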